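/- Let $\mathcal H^R,\mathcal H^A,\mathcal H^B$ be finite-dimensional Hilbert spaces, let $\mathcal H^{B'}$ be a copy of $\mathcal H^A$, and let $|\psi\rangle^{RAB}\in\mathcal H^R\otimes\mathcal H^A\otimes\mathcal H^B$ be a unit vector with reduced states $\psi^{AB}=\mathrm{tr}_R|\psi\rangle\langle\psi|$ and $\psi^{B}=\mathrm{tr}_{RA}|\psi\rangle\langle\psi|$. For an integer $K\ge 1$ and spaces $\mathcal H^{\overline A},\mathcal H^{\overline B}$ of finite dimension at least $K$, let $|\Phi_K^+\rangle^{\overline A\,\overline B}=\frac1{\sqrt K}\sum_{l=0}^{K-1}|l\rangle\otimes|l\rangle$, and write $\psi$, $\Phi^+_K$ for the corresponding rank-one projections. An algorithm for exact state merging of $|\psi\rangle^{RAB}$ with integers $K,L\ge 1$ (and finite dimensions $\dim\mathcal H^{\overline A},\dim\mathcal H^{\overline B}\ge\max\{K,L\}$) is an LOCC map $\mathcal M$ between the party holding $A,\overline A$ and the party holding $B,\overline B$, from operators on $\mathcal H^A\otimes\mathcal H^B\otimes\mathcal H^{\overline A}\otimes\mathcal H^{\overline B}$ to operators on $\mathcal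 H^{B'}\otimes\mathcal H^B\otimes\mathcal H^{\overline A}\otimes\mathcal H^{\overline B}$ (after which the first party holds $\overline A$ and the second holds $B',B,\overline B$), such that $$(\mathrm{id}^R\otimes\mathcal M)\bigl(\psi^{RAB}\otimes{\Phi^+_K}^{\overline A\,\overline B}\bigr)=\psi^{RB'B}\otimes{\Phi^+_L}^{\overline A\,\overline B}.$$ Here LOCC is two-way: a finite-round LOCC instrument is obtained by successive one-way local instruments (one party performs a quantum instrument with at most countably many outcomes and announces the outcome, the other applies a channel depending on it), each chosen depending on the outcomes so far, with coarse-graining of outcomes allowed; LOCC maps are the total channels of finite-round protocols and, more generally, the limits of the total channels of sequences of finite-round LOCC instruments each of which continues the preceding one (infinitely many rounds), followed by local channels. The algorithm is non-catalytic if $L=1$. For positive semidefinite operators $X,Y$, possibly on spaces of different dimensions, $X\prec Y$ means that $X$ is majorized by $Y$: $\mathrm{tr}X=\mathrm{tr}Y$ and for every $k$ the sum of the $k$ largest eigenvalues of $X$ is at most that of $Y$ (spectra being filled up with zeros). Let $\mathbb 1_K$ be the identity on $\mathbb C^K$. Then the set $\{\log_2K-\log_2L:\ K,L\in\mathbb Z_{\ge1},\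 \frac{\mathbb 1_K}{K}\otimes\psi^B\prec\frac{\mathbb 1_L}{L}\otimes\psi^{AB}\}$ is non-empty and bounded below, and every algorithm for exact state merging of $|\psi\rangle^{RAB}$ satisfies $$\log_2K-\log_2L\ \ge\ \inf\Bigl\{\log_2K-\log_2L:\ \tfrac{\mathbb 1_K}{K}\otimes\psi^B\prec\tfrac{\mathbb 1_L}{L}\otimes\psi^{AB}\Bigr\}.$$ Likewise the set $\{\log_2K:\ K\in\mathbb Z_{\ge1},\ \frac{\mathbb 1_K}{K}\otimes\psi^B\prec\psi^{AB}\}$ has a least element, and every algorithm for non-catalytic exact state merging of $|\psi\rangle^{RAB}$ satisfies $$\log_2K\ \ge\ \min\Bigl\{\log_2K:\ \tfrac{\mathbb 1_K}{K}\otimes\psi^B\prec\psi^{AB}\Bigr\}.$$ -/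

import Mathlib

open scoped Kronecker ComplexOrder

/-! Finite-dimensional systems are coordinatized: the system with orthonormal basis indexed by a
finite type `n` is `ℂ^n`, and its operators are the matrices `Matrix n n ℂ`. -/

/-- Linear maps from operators on `ℂ^n` to operators on `ℂ^m`. -/
abbrev SuperOp (n m : Type) := Matrix n n ℂ →ₗ[ℂ] Matrix m m ℂ

/-- The operator `|v⟩⟨v|`. -/
def pureOp {n : Type} (v : n → ℂ) : Matrix n n ℂ := Matrix.vecMulVec v (star v)

/-- Partial trace over the first tensor factor. -/
def ptraceFst {x y : Type} [Fintype x] (ρ : Matrix (x × y) (x × y) ℂ) : Matrix y y ℂ :=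
  Matrix.of fun j j' => ∑ i, ρ (i, j) (i, j')

section Channels

variable {n m n' m' : Type} [Fintype n] [Fintype m]

/-- Complete positivity (Kraus form). -/
def IsCP (E : SuperOp n m) : Prop :=
  ∃ (r : ℕ) (V : Fin r → Matrix m n ℂ), ∀ X, E X = ∑ i, V i * X * (V i).conjTranspose

/-- Quantum channels: completely positive trace-preserving maps. -/
def IsChannel (E : SuperOp n m) : Prop :=
  IsCP E ∧ ∀ X, (E X).trace = X.trace

/-- Quantum instruments with at most countably many outcomes: completely positive maps whose sum is
trace preserving. Outcomes are labelled by natural numbers; labels that are not in use carry the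
zero map. -/
def IsInstrument (E : ℕ → SuperOp n m) : Prop :=
  (∀ j, IsCP (E j)) ∧ ∀ X, HasSum (fun j => (E j X).trace) X.trace

/-- The tensor product `E ⊗ F` of two linear maps between operator spaces. -/
def tensorMap [DecidableEq n] [DecidableEq m] (E : SuperOp n n') (F : SuperOp m m') :
    SuperOp (n × m) (n' × m') where
  toFun X := ∑ p : n × m, ∑ q : n × m,
    X p q • (E (Matrix.single p.1 q.1 1) ⊗ₖ F (Matrix.single p.2 q.2 1))
  map_add' X Y := by
    simp [add_smul, Finset.sum_add_distrib]
  map_smul' c X := by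
    simp [Finset.smul_sum, mul_smul]

/-- The defining property of `E ⊗ F`. -/
theorem tensorMap_kronecker [DecidableEq n] [DecidableEq m] (E : SuperOp n n')
    (F : SuperOp m m') (X : Matrix n n ℂ) (Y : Matrix m m ℂ) :
    tensorMap E F (X ⊗ₖ Y) = E X ⊗ₖ F Y := by
  have hE : E X = ∑ i, ∑ j, X i j • E (Matrix.single i j 1) := by
    conv_lhs => rw [Matrix.matrix_eq_sum_single X]
    simp only [map_sum]
    refine Finset.sum_congr rfl fun i _ => Finset.sum_congr rfl fun j _ => ?_
    rw [← map_smul, Matrix.smul_single, smul_eq_mul, mul_one]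
  have hF : F Y = ∑ i, ∑ j, Y i j • F (Matrix.single i j 1) := by
    conv_lhs => rw [Matrix.matrix_eq_sum_single Y]
    simp only [map_sum]
    refine Finset.sum_congr rfl fun i _ => Finset.sum_congr rfl fun j _ => ?_
    rw [← map_smul, Matrix.smul_single, smul_eq_mul, mul_one]
  ext ⟨a, b⟩ ⟨a', b'⟩
  rw [hE, hF]
  simp only [tensorMap, LinearMap.coe_mk, AddHom.coe_mk, Matrix.sum_apply, Matrix.smul_apply,
    Matrix.kroneckerMap_apply, smul_eq_mul, Fintype.sum_prod_type, Finset.sum_mul_sum]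
  refine Finset.sum_congr rfl fun i _ => Finset.sum_congr rfl fun k _ =>
    Finset.sum_congr rfl fun j _ => Finset.sum_congr rfl fun l _ => ?_
  ring

/-- `G` is a coarse-graining of the family `E`: outcomes are merged along a relabelling. -/
def IsCoarseGraining {ι : Type} (E : ι → SuperOp n m) (G : ℕ → SuperOp n m) : Prop :=
  ∃ f : ι → ℕ, ∀ k X, HasSum (fun p : {p : ι // f p = k} => E p.1 X) (G k X)

end Channels

section LOCC

variable {a b a₁ b₁ a₂ b₂ : Type} [Fintype a] [Fintype b] [Fintype a₁] [Fintype b₁]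
  [Fintype a₂] [Fintype b₂] [DecidableEq a] [DecidableEq b] [DecidableEq a₁] [DecidableEq b₁]
  [DecidableEq a₂] [DecidableEq b₂]

/-- One-way local instruments: one of the two parties performs an instrument and announces the
outcome `j`, and the other party applies a channel depending on `j`. -/
def IsOneWayLocal (E : ℕ → SuperOp (a × b) (a₁ × b₁)) : Prop :=
  (∃ (F : ℕ → SuperOp a a₁) (T : ℕ → SuperOp b b₁),
    IsInstrument F ∧ (∀ j, IsChannel (T j)) ∧ ∀ j, E j = tensorMap (F j) (T j)) ∨
  (∃ (T : ℕ → SuperOp a a₁) (F : ℕ → SuperOp b b₁),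
    IsInstrument F ∧ (∀ j, IsChannel (T j)) ∧ ∀ j, E j = tensorMap (T j) (F j))

/-- `G` is LOCC linked to `E`: after outcome `j` of `E`, a one-way local instrument depending on `j`
is performed (also the acting party may depend on `j`), and outcomes may be merged. -/
def IsLOCCLinked (E : ℕ → SuperOp (a × b) (a₁ × b₁)) (G : ℕ → SuperOp (a × b) (a₂ × b₂)) : Prop :=
  ∃ C : ℕ → ℕ → SuperOp (a₁ × b₁) (a₂ × b₂), (∀ j, IsOneWayLocal (C j)) ∧
    IsCoarseGraining (fun p : ℕ × ℕ => (C p.1 p.2).comp (E p.1)) G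

/-- Two-way LOCC instruments with finitely many rounds of communication. The local systems may
change from round to round. -/
inductive IsFiniteLOCC : ∀ {a₁ b₁ : Type} [Fintype a₁] [Fintype b₁] [DecidableEq a₁]
    [DecidableEq b₁], (ℕ → SuperOp (a × b) (a₁ × b₁)) → Prop
  | first {a₁ b₁ : Type} [Fintype a₁] [Fintype b₁] [DecidableEq a₁] [DecidableEq b₁]
      {E G : ℕ → SuperOp (a × b) (a₁ × b₁)} :
      IsOneWayLocal E → IsCoarseGraining E G → IsFiniteLOCC G
  | next {a₁ b₁ a₂ b₂ : Type} [Fintype a₁] [Fintype b₁] [DecidableEq a₁] [DecidableEq b₁]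
      [Fintype a₂] [Fintype b₂] [DecidableEq a₂] [DecidableEq b₂]
      {E : ℕ → SuperOp (a × b) (a₁ × b₁)} {G : ℕ → SuperOp (a × b) (a₂ × b₂)} :
      IsFiniteLOCC E → IsLOCCLinked E G → IsFiniteLOCC G

/-- LOCC maps, with two-way communication and finitely or infinitely many rounds. There is a
sequence of finite-round LOCC instruments `J ν`, acting into some local working systems, such that
each is LOCC linked to the preceding one, and their total channels `S ν`, followed by a final local
decoding `DA ⊗ DB` from the working systems to the output systems, converge to `M`. (For a
finite-round protocol the sequence can be taken constant.) -/
def IsLOCC (M : SuperOp (a × b) (a₁ × b₁)) : Prop :=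
  ∃ (d e : ℕ) (J : ℕ → ℕ → SuperOp (a × b) (Fin d × Fin e))
    (S : ℕ → SuperOp (a × b) (Fin d × Fin e)) (DA : SuperOp (Fin d) a₁) (DB : SuperOp (Fin e) b₁),
    (∀ ν, IsFiniteLOCC (J ν)) ∧ (∀ ν, IsLOCCLinked (J ν) (J (ν + 1))) ∧
    (∀ ν X, HasSum (fun j => J ν j X) (S ν X)) ∧ IsChannel DA ∧ IsChannel DB ∧
    ∀ X, Filter.Tendsto (fun ν => tensorMap DA DB (S ν X)) Filter.atTop (nhds (M X))

end LOCC

section Majorization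

variable {n m : Type} [Fintype n] [Fintype m] [DecidableEq n] [DecidableEq m]

/-- The eigenvalues of a Hermitian matrix in descending order, continued by zeros. -/
noncomputable def sortedEigenvalue {X : Matrix n n ℂ} (hX : X.IsHermitian) (i : ℕ) : ℝ :=
  if h : i < Fintype.card n then hX.eigenvalues₀ ⟨i, h⟩ else 0

/-- Majorization `X ≺ Y` of positive semidefinite operators, possibly on spaces of different
dimensions (spectra are filled up with zeros). -/
def Majorized (X : Matrix n n ℂ) (Y : Matrix m m ℂ) : Prop :=
  ∃ (hX : X.PosSemidef) (hY : Y.PosSemidef),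
    (∀ k : ℕ, ∑ i ∈ Finset.range k, sortedEigenvalue hX.isHermitian i ≤
      ∑ i ∈ Finset.range k, sortedEigenvalue hY.isHermitian i) ∧
    ∑ i, hX.isHermitian.eigenvalues₀ i = ∑ i, hY.isHermitian.eigenvalues₀ i

end Majorization

/-- The completely mixed state `𝟙_K / K`. -/
noncomputable def maxMixed (K : ℕ) : Matrix (Fin K) (Fin K) ℂ := (K : ℂ)⁻¹ • 1

/-- The maximally entangled vector of Schmidt rank `K` in `ℂ^p ⊗ ℂ^q`, for `K ≤ p` and `K ≤ q`. -/
noncomputable def maxEnt (K p q : ℕ) : Fin p × Fin q → ℂ := fun i =>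
  if i.1.val = i.2.val ∧ i.1.val < K then ((Real.sqrt K : ℝ) : ℂ)⁻¹ else 0

section Merging

variable {R A B : Type} [Fintype R] [Fintype A] [Fintype B] [DecidableEq R] [DecidableEq A]
  [DecidableEq B]

/-- The reduced state on `AB`. -/
def reducedAB (ψ : EuclideanSpace ℂ (R × A × B)) : Matrix (A × B) (A × B) ℂ :=
  ptraceFst (pureOp fun i => ψ i)

/-- The reduced state on `B`. -/
def reducedB (ψ : EuclideanSpace ℂ (R × A × B)) : Matrix B B ℂ :=
  ptraceFst (reducedAB ψ)

/-- The vector `ψ ⊗ Φ_K` before merging. Party `A` holds `A` and its share (of dimension `p`) of the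
resource, party `B` holds `B` and its share (of dimension `q`). -/
noncomputable def mergingInput (ψ : EuclideanSpace ℂ (R × A × B)) (K p q : ℕ) :
    R × ((A × Fin p) × (B × Fin q)) → ℂ :=
  fun i => ψ (i.1, i.2.1.1, i.2.2.1) * maxEnt K p q (i.2.1.2, i.2.2.2)

/-- The vector `ψ ⊗ Φ_L` after merging. Party `A` holds only its share of the resource, and party
`B` holds `B'` (a copy of `A`), `B` and its share of the resource. -/
noncomputable def mergingOutput (ψ : EuclideanSpace ℂ (R × A × B)) (L p q : ℕ) :
    R × (Fin p × ((A × B) × Fin q)) → ℂ :=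
  fun i => ψ (i.1, i.2.2.1.1, i.2.2.1.2) * maxEnt L p q (i.2.1, i.2.2.2)

/-- `M` is an LOCC map achieving exact state merging of `ψ`, from a resource of Schmidt rank `K` to a
resource of Schmidt rank `L`. -/
structure IsExactMerging (ψ : EuclideanSpace ℂ (R × A × B)) (K L : ℕ) {p q : ℕ}
    (M : SuperOp ((A × Fin p) × (B × Fin q)) (Fin p × ((A × B) × Fin q))) : Prop where
  one_le_K : 1 ≤ K
  one_le_L : 1 ≤ L
  K_le : K ≤ p ∧ K ≤ q
  L_le : L ≤ p ∧ L ≤ q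
  locc : IsLOCC M
  achieves : tensorMap (LinearMap.id : SuperOp R R) M (pureOp (mergingInput ψ K p q)) =
    pureOp (mergingOutput ψ L p q)

/-- The set of all `log₂ K - log₂ L` with `𝟙_K/K ⊗ ψ^B ≺ 𝟙_L/L ⊗ ψ^{AB}`. -/
def catalyticCosts (ψ : EuclideanSpace ℂ (R × A × B)) : Set ℝ :=
  {c | ∃ K L : ℕ, 1 ≤ K ∧ 1 ≤ L ∧
    Majorized (maxMixed K ⊗ₖ reducedB ψ) (maxMixed L ⊗ₖ reducedAB ψ) ∧
    c = Real.logb 2 K - Real.logb 2 L}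

/-- The set of all `log₂ K` with `𝟙_K/K ⊗ ψ^B ≺ ψ^{AB}`. -/
def nonCatalyticCosts (ψ : EuclideanSpace ℂ (R × A × B)) : Set ℝ :=
  {c | ∃ K : ℕ, 1 ≤ K ∧ Majorized (maxMixed K ⊗ₖ reducedB ψ) (reducedAB ψ) ∧ c = Real.logb 2 K}

end Merging

/-! Give the reference system to the first party and look at the cut `RA : B`. Both the input `ψ ⊗
Φ_K` and the output `ψ ⊗ Φ_L` are pure, and their reduced states on the second party are `𝟙_K/K ⊗
ψ^B` and `𝟙_L/L ⊗ ψ^{AB}`, up to unused dimensions. So everything follows from the necessary half of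
Nielsen's theorem, that pure-state LOCC can only increase the Ky Fan sums of a reduced state
(`IsLOCC.kyFan_le`). It has to hold for countably many outcomes and infinitely many rounds. Tracking
protocols branch by branch is avoided. Two properties survive composition, coarse-graining and
limits: the map sends the closed cone of operators of Schmidt number at most `k` into itself, and it
preserves the trace on these cones (`IsLOCC.preservesSchmidt`). Defining the cone by its dual
functionals makes closedness and invariance immediate. Now let `v` go to `χ`, let `s` and `S` be the
sums of the `k` largest eigenvalues of the two reduced states, and let `φ` be `v` with its second
part projected to the top `k` eigenvectors, so `⟨v,φ⟩ = ⟨φ,φ⟩ = s`. The image of `φ` has Schmidt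
number at most `k` and trace `s`, so its expectation in `χ` is at most `S s`. Conversely the
functional `g = ⟨χ|Λ(·)|χ⟩`, with `Λ = id ⊗ M`, lies between zero and the trace on pure operators
and attains the trace at `v`; testing it on `v + tφ` gives `g(φ) ≥ s²`. Hence `s ≤ S`. That the cost
sets are non-empty and bounded below is elementary: a tensor factor `𝟙_K/K` caps all eigenvalues at
`1/K`. -/

/-! ### Tensor products of superoperators: blocks, Kraus form, traces -/

section SuperOperators

variable {R n m n' m' : Type} [Fintype R] [Fintype n] [Fintype m] [DecidableEq R] [DecidableEq n]
  [DecidableEq m]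

theorem superOp_eq_sum_single (E : SuperOp n n') (X : Matrix n n ℂ) :
    E X = ∑ i, ∑ j, X i j • E (Matrix.single i j 1) := by
  conv_lhs => rw [Matrix.matrix_eq_sum_single X]
  simp only [map_sum]
  refine Finset.sum_congr rfl fun i _ => Finset.sum_congr rfl fun j _ => ?_
  rw [← map_smul, Matrix.smul_single, smul_eq_mul, mul_one]

/-- Because `id ⊗ M` acts separately on each `R`-block, composition, infinite sums and limits of `M`
transfer to it entrywise. -/
theorem tensorMap_id_apply (M : SuperOp n n') (X : Matrix (R × n) (R × n) ℂ) (r r' : R)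
    (y y' : n') :
    tensorMap (LinearMap.id : SuperOp R R) M X (r, y) (r', y') =
      M (X.submatrix (Prod.mk r) (Prod.mk r')) y y' := by
  rw [superOp_eq_sum_single M]
  simp only [tensorMap, LinearMap.coe_mk, AddHom.coe_mk, Matrix.sum_apply, Matrix.smul_apply,
    Matrix.kroneckerMap_apply, smul_eq_mul, Fintype.sum_prod_type, LinearMap.id_apply,
    Matrix.submatrix_apply]
  rw [Finset.sum_eq_single r]
  · refine Finset.sum_congr rfl fun i _ => ?_
    rw [Finset.sum_eq_single r']
    · simp
    · intro b _ hb
      simp [hb]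
    · simp
  · intro b _ hb
    simp [hb]
  · simp

theorem tensorMap_id_comp {l : Type} (M : SuperOp n m) (N : SuperOp m l)
    (X : Matrix (R × n) (R × n) ℂ) :
    tensorMap (LinearMap.id : SuperOp R R) (N.comp M) X =
      tensorMap (LinearMap.id : SuperOp R R) N (tensorMap (LinearMap.id : SuperOp R R) M X) := by
  ext ⟨r, y⟩ ⟨r', y'⟩
  rw [tensorMap_id_apply, tensorMap_id_apply, LinearMap.comp_apply]
  have : (tensorMap (LinearMap.id : SuperOp R R) M X).submatrix (Prod.mk r) (Prod.mk r') =
      M (X.submatrix (Prod.mk r) (Prod.mk r')) := by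
    ext i j
    rw [Matrix.submatrix_apply, tensorMap_id_apply]
  rw [this]

theorem hasSum_tensorMap_id {ι : Type} {E : ι → SuperOp n n'} {G : SuperOp n n'}
    (h : ∀ X, HasSum (fun i => E i X) (G X)) (X : Matrix (R × n) (R × n) ℂ) :
    HasSum (fun i => tensorMap (LinearMap.id : SuperOp R R) (E i) X)
      (tensorMap (LinearMap.id : SuperOp R R) G X) := by
  refine Pi.hasSum.2 fun p => Pi.hasSum.2 fun q => ?_
  obtain ⟨r, y⟩ := p
  obtain ⟨r', y'⟩ := q
  simp only [tensorMap_id_apply]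
  exact Pi.hasSum.1 (Pi.hasSum.1 (h _) y) y'

theorem tendsto_tensorMap_id {ι : Type} {l : Filter ι} {E : ι → SuperOp n n'} {G : SuperOp n n'}
    (h : ∀ X, Filter.Tendsto (fun i => E i X) l (nhds (G X))) (X : Matrix (R × n) (R × n) ℂ) :
    Filter.Tendsto (fun i => tensorMap (LinearMap.id : SuperOp R R) (E i) X) l
      (nhds (tensorMap (LinearMap.id : SuperOp R R) G X)) := by
  refine tendsto_pi_nhds.2 fun p => tendsto_pi_nhds.2 fun q => ?_
  obtain ⟨r, y⟩ := p
  obtain ⟨r', y'⟩ := q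
  simp only [tensorMap_id_apply]
  exact tendsto_pi_nhds.1 (tendsto_pi_nhds.1 (h _) y) y'

theorem superOp_ext {E F : SuperOp n n'}
    (h : ∀ i j, E (Matrix.single i j 1) = F (Matrix.single i j 1)) : E = F := by
  refine LinearMap.ext fun X => ?_
  rw [superOp_eq_sum_single E, superOp_eq_sum_single F]
  simp only [h]

/-- The map `X ↦ ∑ i, V i * X * (V i)ᴴ`. -/
def krausMap {r : Type} [Fintype r] (V : r → Matrix n' n ℂ) : SuperOp n n' where
  toFun X := ∑ i, V i * X * (V i).conjTranspose
  map_add' X Y := by simp [Matrix.mul_add, Matrix.add_mul, Finset.sum_add_distrib]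
  map_smul' c X := by simp [Finset.smul_sum]

theorem tensorMap_kraus {r s : Type} [Fintype r] [Fintype s] {E : SuperOp n n'} {F : SuperOp m m'}
    {V : r → Matrix n' n ℂ} {W : s → Matrix m' m ℂ}
    (hE : ∀ X, E X = ∑ i, V i * X * (V i).conjTranspose)
    (hF : ∀ X, F X = ∑ i, W i * X * (W i).conjTranspose) (X : Matrix (n × m) (n × m) ℂ) :
    tensorMap E F X =
      ∑ p : r × s, (V p.1 ⊗ₖ W p.2) * X * (V p.1 ⊗ₖ W p.2).conjTranspose := by
  have : tensorMap E F = krausMap fun p : r × s => V p.1 ⊗ₖ W p.2 := by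
    refine superOp_ext fun p q => ?_
    have hs : (Matrix.single p q 1 : Matrix (n × m) (n × m) ℂ) =
        Matrix.single p.1 q.1 1 ⊗ₖ Matrix.single p.2 q.2 1 := by
      rw [Matrix.single_kronecker_single, mul_one]
    rw [hs, tensorMap_kronecker, hE, hF]
    change _ = ∑ p : r × s, _
    rw [Fintype.sum_prod_type]
    ext ⟨a, b⟩ ⟨a', b'⟩
    simp only [Matrix.conjTranspose_kronecker, ← Matrix.mul_kronecker_mul,
    Matrix.kroneckerMap_apply,
      Matrix.sum_apply, Finset.sum_mul_sum]
  rw [this]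
  rfl

theorem trace_tensorMap [Fintype n'] [Fintype m'] (E : SuperOp n n') (F : SuperOp m m')
    (X : Matrix (n × m) (n × m) ℂ) :
    (tensorMap E F X).trace = ∑ p : n × m, ∑ q : n × m,
      X p q * ((E (Matrix.single p.1 q.1 1)).trace * (F (Matrix.single p.2 q.2 1)).trace) := by
  simp only [tensorMap, LinearMap.coe_mk, AddHom.coe_mk, Matrix.trace_sum, Matrix.trace_smul,
    Matrix.trace_kronecker, smul_eq_mul]

theorem trace_tensorMap_id [Fintype n'] (M : SuperOp n n') (X : Matrix (R × n) (R × n) ℂ) :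
    (tensorMap (LinearMap.id : SuperOp R R) M X).trace = (M (ptraceFst X)).trace := by
  have : ptraceFst X = ∑ r : R, X.submatrix (Prod.mk r) (Prod.mk r) := by
    ext i j
    simp [ptraceFst, Matrix.sum_apply]
  rw [this, map_sum, Matrix.trace_sum, Matrix.trace, Fintype.sum_prod_type]
  refine Finset.sum_congr rfl fun r _ => Finset.sum_congr rfl fun y _ => ?_
  rw [Matrix.diag_apply, tensorMap_id_apply]
  rfl

theorem trace_ptraceFst {R n : Type} [Fintype R] [Fintype n]
    (X : Matrix (R × n) (R × n) ℂ) : (ptraceFst X).trace = X.trace := by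
  simp only [Matrix.trace, Matrix.diag_apply, ptraceFst, Matrix.of_apply, Fintype.sum_prod_type]
  exact Finset.sum_comm

/-- This puts the trace in the same shape as `trace_tensorMap`, so that trace preservation can be
read off factor by factor. -/
theorem trace_eq_sum_trace_single (X : Matrix (n × m) (n × m) ℂ) :
    X.trace = ∑ p : n × m, ∑ q : n × m, X p q * ((Matrix.single p.1 q.1 (1 : ℂ)).trace *
      (Matrix.single p.2 q.2 (1 : ℂ)).trace) := by
  rw [Matrix.trace]
  refine Finset.sum_congr rfl fun p _ => ?_
  rw [Finset.sum_eq_single p]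
  · simp
  · intro q _ hq
    have : p.1 ≠ q.1 ∨ p.2 ≠ q.2 := by
      by_contra! h
      exact hq (Prod.ext h.1.symm h.2.symm)
    rcases this with h | h
    · rw [Matrix.trace_single_eq_of_ne _ _ _ h]; simp
    · rw [Matrix.trace_single_eq_of_ne _ _ _ h]; simp
  · simp

end SuperOperators

/-! ### Schmidt number cones and their invariance under LOCC -/

section SchmidtRank

variable {R a b a₁ b₁ : Type} [Fintype R] [Fintype a] [Fintype b] [Fintype a₁] [Fintype b₁]
  [DecidableEq R] [DecidableEq a] [DecidableEq b] [DecidableEq a₁] [DecidableEq b₁]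

/-- The component of `φ ∈ (ℂ^R ⊗ ℂ^a) ⊗ ℂ^b` at a basis vector of `ℂ^R ⊗ ℂ^a`. -/
def slice (φ : R × (a × b) → ℂ) (α : R × a) : EuclideanSpace ℂ b :=
  WithLp.toLp 2 fun y => φ (α.1, (α.2, y))

/-- The Schmidt rank of `φ` across the cut `Ra : b` is at most `k`. -/
def SchmidtLE (k : ℕ) (φ : R × (a × b) → ℂ) : Prop :=
  ∃ s : Submodule ℂ (EuclideanSpace ℂ b), Module.finrank ℂ s ≤ k ∧ ∀ α, slice φ α ∈ s

theorem schmidtLE_card {R a b : Type} [Fintype b] (φ : R × (a × b) → ℂ) :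
    SchmidtLE (Fintype.card b) φ :=
  ⟨⊤, by simp, fun _ => trivial⟩

/-- The closed convex cone generated by the operators `|φ⟩⟨φ|` with `φ` of Schmidt rank at most
`k`, described by duality. -/
def schmidtCone (R a b : Type) [Fintype R] [Fintype a] [Fintype b] (k : ℕ) :
    Set (Matrix (R × (a × b)) (R × (a × b)) ℂ) :=
  {ρ | ∀ f : Matrix (R × (a × b)) (R × (a × b)) ℂ →ₗ[ℂ] ℂ,
    (∀ φ, SchmidtLE k φ → 0 ≤ (f (pureOp φ)).re) → 0 ≤ (f ρ).re}

/-- `id ⊗ M` does not increase the Schmidt number. -/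
def PreservesSchmidt (R : Type) [Fintype R] [DecidableEq R] (M : SuperOp (a × b) (a₁ × b₁)) : Prop :=
  ∀ k, ∀ ρ ∈ schmidtCone R a b k,
    tensorMap (LinearMap.id : SuperOp R R) M ρ ∈ schmidtCone R a₁ b₁ k

theorem pureOp_mem_schmidtCone {R a b : Type} [Fintype R] [Fintype a] [Fintype b] {k : ℕ}
    {φ : R × (a × b) → ℂ} (h : SchmidtLE k φ) : pureOp φ ∈ schmidtCone R a b k :=
  fun _ hf => hf φ h

theorem SchmidtLE.map_kronecker {R a b a₁ b₁ : Type} [Fintype a] [Fintype b] [DecidableEq b]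
    {k : ℕ} {φ : R × (a × b) → ℂ} (h : SchmidtLE k φ)
    (V : Matrix a₁ a ℂ) (W : Matrix b₁ b ℂ) :
    SchmidtLE k fun i : R × (a₁ × b₁) => ((V ⊗ₖ W).mulVec fun x => φ (i.1, x)) i.2 := by
  obtain ⟨s, hs, hφ⟩ := h
  refine ⟨s.map (Matrix.toEuclideanLin W), (Submodule.finrank_map_le _ _).trans hs, ?_⟩
  rintro ⟨r, y⟩
  have : slice (fun i : R × (a₁ × b₁) => ((V ⊗ₖ W).mulVec fun x => φ (i.1, x)) i.2) (r, y) =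
      ∑ x : a, V y x • Matrix.toEuclideanLin W (slice φ (r, x)) := by
    ext z
    simp only [slice, Matrix.mulVec, dotProduct, Fintype.sum_prod_type, Matrix.kroneckerMap_apply,
      WithLp.ofLp_sum, WithLp.ofLp_smul, Finset.sum_apply, Pi.smul_apply, smul_eq_mul,
      Matrix.toLpLin_toLp, Matrix.toLin'_apply, Finset.mul_sum, mul_assoc]
  rw [this]
  exact Submodule.sum_mem _ fun x _ => Submodule.smul_mem _ _
    (Submodule.mem_map_of_mem (hφ _))

/-- Product Kraus operators `V ⊗ W` cannot raise the Schmidt rank: the new slices lie in the image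
under `W` of the space containing the old ones. -/
theorem preservesSchmidt_tensorMap {F : SuperOp a a₁} {T : SuperOp b b₁} (hF : IsCP F)
    (hT : IsCP T) : PreservesSchmidt R (tensorMap F T) := by
  obtain ⟨r, V, hV⟩ := hF
  obtain ⟨s, W, hW⟩ := hT
  intro k ρ hρ f hf
  -- The cone being a dual, it suffices to pull the functional back and test it on pure generators.
  refine hρ (f ∘ₗ tensorMap LinearMap.id (tensorMap F T)) fun φ hφ => ?_
  have : tensorMap (LinearMap.id : SuperOp R R) (tensorMap F T) (pureOp φ) =
      ∑ p : Fin r × Fin s, pureOp fun i : R × (a₁ × b₁) =>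
        ((V p.1 ⊗ₖ W p.2).mulVec fun x => φ (i.1, x)) i.2 := by
    ext ⟨r, y⟩ ⟨r', y'⟩
    rw [tensorMap_id_apply, tensorMap_kraus hV hW, Matrix.sum_apply, Matrix.sum_apply]
    refine Finset.sum_congr rfl fun p _ => ?_
    have h1 : (pureOp φ).submatrix (Prod.mk r) (Prod.mk r') =
        Matrix.vecMulVec (fun x => φ (r, x)) (star fun x => φ (r', x)) := rfl
    rw [h1, Matrix.mul_vecMulVec, Matrix.vecMulVec_mul, ← Matrix.star_mulVec]
    rfl
  rw [LinearMap.comp_apply, this, map_sum, Complex.re_sum]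
  exact Finset.sum_nonneg fun p _ => hf _ (hφ.map_kronecker _ _)

theorem PreservesSchmidt.comp {a₂ b₂ : Type} [Fintype a₂] [Fintype b₂]
    {N : SuperOp (a₁ × b₁) (a₂ × b₂)} {M : SuperOp (a × b) (a₁ × b₁)} (hN : PreservesSchmidt R N)
    (hM : PreservesSchmidt R M) : PreservesSchmidt R (N.comp M) := by
  intro k ρ hρ
  rw [tensorMap_id_comp]
  exact hN k _ (hM k _ hρ)

/-- An intersection of closed half-spaces; this is what admits infinitely many outcomes and rounds.
-/
theorem isClosed_schmidtCone {R a b : Type} [Fintype R] [Fintype a] [Fintype b] (k : ℕ) :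
    IsClosed (schmidtCone R a b k) := by
  have : schmidtCone R a b k = ⋂ f : Matrix (R × (a × b)) (R × (a × b)) ℂ →ₗ[ℂ] ℂ,
      ⋂ _ : ∀ φ, SchmidtLE k φ → 0 ≤ (f (pureOp φ)).re, {ρ | 0 ≤ (f ρ).re} := by
    ext ρ
    simp [schmidtCone]
  rw [this]
  exact isClosed_iInter fun f => isClosed_iInter fun _ => isClosed_le continuous_const
    (Complex.continuous_re.comp f.continuous_of_finiteDimensional)

theorem sum_mem_schmidtCone {R a b ι : Type} [Fintype R] [Fintype a] [Fintype b] {k : ℕ}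
    (s : Finset ι) {ρ : ι → Matrix (R × (a × b)) (R × (a × b)) ℂ}
    (h : ∀ i, ρ i ∈ schmidtCone R a b k) : ∑ i ∈ s, ρ i ∈ schmidtCone R a b k := by
  intro f hf
  rw [map_sum, Complex.re_sum]
  exact Finset.sum_nonneg fun i _ => h i f hf

theorem PreservesSchmidt.hasSum {R a b a₁ b₁ : Type} [Fintype R] [Fintype a] [Fintype b]
    [Fintype a₁] [Fintype b₁] [DecidableEq R] [DecidableEq a] [DecidableEq b] {ι : Type}
    {E : ι → SuperOp (a × b) (a₁ × b₁)}
    {G : SuperOp (a × b) (a₁ × b₁)} (h : ∀ i, PreservesSchmidt R (E i))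
    (hG : ∀ X, HasSum (fun i => E i X) (G X)) : PreservesSchmidt R G := fun k ρ hρ =>
  (isClosed_schmidtCone k).mem_of_tendsto (hasSum_tensorMap_id hG ρ)
    (Filter.Eventually.of_forall fun s => sum_mem_schmidtCone s fun i => h i k ρ hρ)

theorem PreservesSchmidt.tendsto {R a b a₁ b₁ : Type} [Fintype R] [Fintype a] [Fintype b]
    [Fintype a₁] [Fintype b₁] [DecidableEq R] [DecidableEq a] [DecidableEq b]
    {E : ℕ → SuperOp (a × b) (a₁ × b₁)}
    {G : SuperOp (a × b) (a₁ × b₁)} (h : ∀ i, PreservesSchmidt R (E i))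
    (hG : ∀ X, Filter.Tendsto (fun i => E i X) Filter.atTop (nhds (G X))) :
    PreservesSchmidt R G := fun k ρ hρ =>
  (isClosed_schmidtCone k).mem_of_tendsto (tendsto_tensorMap_id hG ρ)
    (Filter.Eventually.of_forall fun i => h i k ρ hρ)

theorem re_trace_nonneg {R a b : Type} [Fintype R] [Fintype a] [Fintype b] {k : ℕ}
    {ρ : Matrix (R × (a × b)) (R × (a × b)) ℂ}
    (hρ : ρ ∈ schmidtCone R a b k) : 0 ≤ ρ.trace.re := by
  refine hρ (Matrix.traceLinearMap _ ℂ ℂ) fun φ _ => ?_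
  rw [Matrix.traceLinearMap_apply, Matrix.trace, Complex.re_sum]
  refine Finset.sum_nonneg fun i _ => ?_
  simp only [pureOp, Matrix.diag_apply, Matrix.vecMulVec_apply, Pi.star_apply, Complex.star_def,
    Complex.mul_conj, Complex.ofReal_re]
  exact Complex.normSq_nonneg _

/-- The maps of the family do not increase the Schmidt number, and their sum preserves the trace on
the positive cones. -/
def IsSchmidtInstrument (R : Type) [Fintype R] [DecidableEq R] {ι : Type}
    (E : ι → SuperOp (a × b) (a₁ × b₁)) : Prop :=
  (∀ i, PreservesSchmidt R (E i)) ∧ ∀ k, ∀ ρ ∈ schmidtCone R a b k,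
    HasSum (fun i => (tensorMap (LinearMap.id : SuperOp R R) (E i) ρ).trace.re) ρ.trace.re

theorem IsOneWayLocal.isSchmidtInstrument {E : ℕ → SuperOp (a × b) (a₁ × b₁)}
    (h : IsOneWayLocal E) : IsSchmidtInstrument R E := by
  have key : ∀ X, HasSum (fun j => (E j X).trace) X.trace := by
    intro X
    rw [trace_eq_sum_trace_single]
    rcases h with ⟨F, T, hF, hT, hE⟩ | ⟨T, F, hF, hT, hE⟩
    · simp only [hE, trace_tensorMap, (hT _).2]
      exact hasSum_sum fun p _ => hasSum_sum fun q _ => ((hF.2 _).mul_right _).mul_left _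
    · simp only [hE, trace_tensorMap, (hT _).2]
      exact hasSum_sum fun p _ => hasSum_sum fun q _ => ((hF.2 _).mul_left _).mul_left _
  refine ⟨fun j => ?_, fun k ρ _ => ?_⟩
  · rcases h with ⟨F, T, hF, hT, hE⟩ | ⟨T, F, hF, hT, hE⟩
    · rw [hE]
      exact preservesSchmidt_tensorMap (hF.1 j) (hT j).1
    · rw [hE]
      exact preservesSchmidt_tensorMap (hT j).1 (hF.1 j)
  · have := key (ptraceFst ρ)
    rw [trace_ptraceFst] at this
    simp only [trace_tensorMap_id]
    exact Complex.hasSum_re this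

theorem IsCoarseGraining.isSchmidtInstrument {ι : Type} {E : ι → SuperOp (a × b) (a₁ × b₁)}
    {G : ℕ → SuperOp (a × b) (a₁ × b₁)} (h : IsCoarseGraining E G)
    (hE : IsSchmidtInstrument R E) : IsSchmidtInstrument R G := by
  obtain ⟨f, hf⟩ := h
  refine ⟨fun k => PreservesSchmidt.hasSum (fun p : {p : ι // f p = k} => hE.1 p.1) (hf k),
    fun k ρ hρ => ?_⟩
  -- The outcomes are regrouped by their merged label, and each fibre sums to the trace of the
  -- merged map.
  have h1 := (Equiv.sigmaFiberEquiv f).hasSum_iff.2 (hE.2 k ρ hρ)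
  refine h1.sigma fun j => ?_
  have h2 := hasSum_tensorMap_id (R := R) (hf j) ρ
  have h3 := h2.map (Matrix.traceAddMonoidHom _ ℂ) (by
    exact (Matrix.traceLinearMap (R × (a₁ × b₁)) ℂ ℂ).continuous_of_finiteDimensional)
  exact Complex.hasSum_re h3

theorem IsSchmidtInstrument.comp {a₂ b₂ : Type} [Fintype a₂] [Fintype b₂] [DecidableEq a₂]
    [DecidableEq b₂] {E : ℕ → SuperOp (a × b) (a₁ × b₁)}
    {C : ℕ → ℕ → SuperOp (a₁ × b₁) (a₂ × b₂)} (hE : IsSchmidtInstrument R E)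
    (hC : ∀ j, IsSchmidtInstrument R (C j)) :
    IsSchmidtInstrument R fun p : ℕ × ℕ => (C p.1 p.2).comp (E p.1) := by
  refine ⟨fun p => ((hC p.1).1 p.2).comp (hE.1 p.1), fun k ρ hρ => ?_⟩
  have h0 : ∀ p : ℕ × ℕ,
      0 ≤ (tensorMap (LinearMap.id : SuperOp R R) ((C p.1 p.2).comp (E p.1)) ρ).trace.re :=
    fun p => re_trace_nonneg (((hC p.1).1 p.2).comp (hE.1 p.1) k ρ hρ)
  have h1 : ∀ j, HasSum (fun l =>
      (tensorMap (LinearMap.id : SuperOp R R) ((C j l).comp (E j)) ρ).trace.re)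
      (tensorMap (LinearMap.id : SuperOp R R) (E j) ρ).trace.re := by
    intro j
    simp only [tensorMap_id_comp]
    exact (hC j).2 k _ (hE.1 j k ρ hρ)
  -- Traces on the cone are nonnegative, so convergence of the iterated sums gives unconditional
  -- summability over pairs of outcomes.
  have h2 : Summable fun p : ℕ × ℕ =>
      (tensorMap (LinearMap.id : SuperOp R R) ((C p.1 p.2).comp (E p.1)) ρ).trace.re := by
    refine (summable_prod_of_nonneg h0).2 ⟨fun j => (h1 j).summable, ?_⟩
    simp only [(h1 _).tsum_eq]
    exact (hE.2 k ρ hρ).summable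
  have h3 := h2.hasSum.prod_fiberwise h1
  have h4 := h2.hasSum
  rwa [h3.unique (hE.2 k ρ hρ)] at h4

theorem IsFiniteLOCC.isSchmidtInstrument {E : ℕ → SuperOp (a × b) (a₁ × b₁)}
    (h : IsFiniteLOCC E) : IsSchmidtInstrument R E := by
  induction h with
  | first hE hG => exact hG.isSchmidtInstrument hE.isSchmidtInstrument
  | next _ hG ih =>
    obtain ⟨C, hC, hG⟩ := hG
    exact hG.isSchmidtInstrument (ih.comp fun j => (hC j).isSchmidtInstrument)

theorem re_trace_tensorMap_channel {F : SuperOp a a₁} {T : SuperOp b b₁} (hF : IsChannel F)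
    (hT : IsChannel T) (ρ : Matrix (R × (a × b)) (R × (a × b)) ℂ) :
    (tensorMap (LinearMap.id : SuperOp R R) (tensorMap F T) ρ).trace = ρ.trace := by
  rw [trace_tensorMap_id, trace_tensorMap, ← trace_ptraceFst ρ,
    trace_eq_sum_trace_single (ptraceFst ρ)]
  simp only [hF.2, hT.2]

/-- Both properties hold for each finite-round total channel followed by the decoding, and pass to
the limit by closedness of the cone and continuity of the trace. -/
theorem IsLOCC.preservesSchmidt {M : SuperOp (a × b) (a₁ × b₁)} (h : IsLOCC M) :
    PreservesSchmidt R M ∧ ∀ k, ∀ ρ ∈ schmidtCone R a b k,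
      (tensorMap (LinearMap.id : SuperOp R R) M ρ).trace.re = ρ.trace.re := by
  obtain ⟨d, e, J, S, DA, DB, hJ, -, hS, hA, hB, hM⟩ := h
  have hI := fun ν => (hJ ν).isSchmidtInstrument (R := R)
  have hP : ∀ ν, PreservesSchmidt R ((tensorMap DA DB).comp (S ν)) := fun ν =>
    (preservesSchmidt_tensorMap hA.1 hB.1).comp (PreservesSchmidt.hasSum (hI ν).1 (hS ν))
  refine ⟨PreservesSchmidt.tendsto hP hM, fun k ρ hρ => ?_⟩
  have ht : ∀ ν, (tensorMap (LinearMap.id : SuperOp R R) ((tensorMap DA DB).comp (S ν)) ρ).trace.re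
      = ρ.trace.re := by
    intro ν
    rw [tensorMap_id_comp, re_trace_tensorMap_channel hA hB]
    have h1 := (hasSum_tensorMap_id (R := R) (hS ν) ρ).map
      (Matrix.traceAddMonoidHom (R × (Fin d × Fin e)) ℂ) (by
        exact (Matrix.traceLinearMap (R × (Fin d × Fin e)) ℂ ℂ).continuous_of_finiteDimensional)
    exact (Complex.hasSum_re h1).unique ((hI ν).2 k ρ hρ)
  have h2 := ((Complex.continuous_re.comp (Matrix.traceLinearMap (R × (a₁ × b₁)) ℂ
    ℂ).continuous_of_finiteDimensional).tendsto _).comp (tendsto_tensorMap_id (R := R)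
      (E := fun ν => (tensorMap DA DB).comp (S ν)) hM ρ)
  refine tendsto_nhds_unique h2 ?_
  refine (tendsto_const_nhds (x := ρ.trace.re)).congr fun ν => ?_
  exact (ht ν).symm

end SchmidtRank

/-! ### Ky Fan sums and the spectral form of quadratic forms -/

section KyFan

variable {n : Type} [Fintype n] [DecidableEq n]

/-- The sum of the `k` largest eigenvalues. -/
noncomputable def kyFan {X : Matrix n n ℂ} (hX : X.IsHermitian) (k : ℕ) : ℝ :=
  ∑ i ∈ Finset.range k, sortedEigenvalue hX i

theorem kyFan_eq_sum {X : Matrix n n ℂ} (hX : X.IsHermitian) (k : ℕ) :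
    kyFan hX k = ∑ i with i.val < k, hX.eigenvalues₀ i := by
  have h1 : ∀ N, k ≤ N → kyFan hX k =
      ∑ i ∈ Finset.range N, if i < k then sortedEigenvalue hX i else 0 := by
    intro N hN
    rw [← Finset.sum_filter, kyFan]
    congr 1
    ext i
    simp only [Finset.mem_range, Finset.mem_filter]
    omega
  have h2 : ∑ i ∈ Finset.range (Fintype.card n), (if i < k then sortedEigenvalue hX i else 0) =
      ∑ i ∈ Finset.range (k + Fintype.card n), if i < k then sortedEigenvalue hX i else 0 := by
    refine Finset.sum_subset (Finset.range_mono (by omega)) fun i _ hi => ?_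
    rw [Finset.mem_range] at hi
    simp [sortedEigenvalue, hi]
  rw [h1 _ (Nat.le_add_right k (Fintype.card n)), ← h2, Finset.sum_range, Finset.sum_filter]
  refine Finset.sum_congr rfl fun i _ => ?_
  simp [sortedEigenvalue]

theorem eigenvalues₀_nonneg {X : Matrix n n ℂ} (hX : X.PosSemidef) (i : Fin (Fintype.card n)) :
    0 ≤ hX.isHermitian.eigenvalues₀ i := by
  have := hX.eigenvalues_nonneg (Fintype.equivOfCardEq (Fintype.card_fin _) i)
  simpa [Matrix.IsHermitian.eigenvalues] using this

theorem kyFan_nonneg {X : Matrix n n ℂ} (hX : X.PosSemidef) (k : ℕ) :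
    0 ≤ kyFan hX.isHermitian k := by
  rw [kyFan_eq_sum]
  exact Finset.sum_nonneg fun i _ => eigenvalues₀_nonneg hX i

theorem sum_eigenvalues₀ {X : Matrix n n ℂ} (hX : X.IsHermitian) :
    ∑ i, hX.eigenvalues₀ i = X.trace.re := by
  rw [hX.trace_eq_sum_eigenvalues, Complex.re_sum]
  exact (Equiv.sum_comp (Fintype.equivOfCardEq (Fintype.card_fin _)).symm hX.eigenvalues₀).symm

/-- Fractional weights with total at most `k` do best on the first `k` entries. Each term is
compared with the threshold value `lam k`; if `k ≥ N` there is no threshold and the bound is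
termwise. -/
theorem sum_antitone_weights_le {N k : ℕ} {lam c : Fin N → ℝ} (h0 : ∀ i, 0 ≤ lam i)
    (hl : Antitone lam) (hc0 : ∀ i, 0 ≤ c i) (hc1 : ∀ i, c i ≤ 1) (hc : ∑ i, c i ≤ k) :
    ∑ i, lam i * c i ≤ ∑ i with i.val < k, lam i := by
  rw [Finset.sum_filter]
  by_cases hk : k < N
  · have h1 : ∀ i, lam i * c i - (if i.val < k then lam i else 0) ≤
        lam ⟨k, hk⟩ * (c i - if i.val < k then 1 else 0) := by
      intro i
      split_ifs with h
      · have : lam ⟨k, hk⟩ ≤ lam i := hl (Fin.le_def.2 h.le)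
        nlinarith [hc1 i]
      · have : lam i ≤ lam ⟨k, hk⟩ := hl (Fin.le_def.2 (not_lt.1 h))
        nlinarith [hc0 i]
    have h2 := Finset.sum_le_sum fun i (_ : i ∈ Finset.univ) => h1 i
    rw [Finset.sum_sub_distrib, ← Finset.mul_sum, Finset.sum_sub_distrib] at h2
    have h3 : ∑ i : Fin N, (if i.val < k then (1 : ℝ) else 0) = k := by
      rw [Finset.sum_boole]
      have : (Finset.univ.filter fun i : Fin N => i.val < k) = Finset.Iio ⟨k, hk⟩ := by
        ext i; simp [Fin.lt_def]
      rw [this, Fin.card_Iio]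
    rw [h3] at h2
    nlinarith [h0 ⟨k, hk⟩]
  · refine Finset.sum_le_sum fun i _ => ?_
    rw [if_pos (by omega)]
    nlinarith [h0 i, hc1 i]

/-- The eigenvectors of a Hermitian matrix, ordered like its sorted eigenvalues. -/
noncomputable def sortedEigenvector {X : Matrix n n ℂ} (hX : X.IsHermitian) :
    OrthonormalBasis (Fin (Fintype.card n)) ℂ (EuclideanSpace ℂ n) :=
  hX.eigenvectorBasis.reindex (Fintype.equivOfCardEq (Fintype.card_fin _)).symm

theorem mulVec_sortedEigenvector {X : Matrix n n ℂ} (hX : X.IsHermitian)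
    (i : Fin (Fintype.card n)) :
    X.mulVec (sortedEigenvector hX i).ofLp =
      hX.eigenvalues₀ i • (sortedEigenvector hX i).ofLp := by
  have := hX.mulVec_eigenvectorBasis (Fintype.equivOfCardEq (Fintype.card_fin _) i)
  simpa [sortedEigenvector, Matrix.IsHermitian.eigenvalues] using this

theorem re_quadForm_eq {X : Matrix n n ℂ} (hX : X.IsHermitian) (x : EuclideanSpace ℂ n) :
    (star x.ofLp ⬝ᵥ X.mulVec x.ofLp).re =
      ∑ i, hX.eigenvalues₀ i * ‖inner ℂ (sortedEigenvector hX i) x‖ ^ 2 := by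
  have h1 : star x.ofLp ⬝ᵥ X.mulVec x.ofLp = inner ℂ x (WithLp.toLp 2 (X.mulVec x.ofLp)) := by
    rw [EuclideanSpace.inner_eq_star_dotProduct, dotProduct_comm]
  have h0 : ∀ y : n → ℂ, Matrix.vecMul (star y) X = star (X.mulVec y) := fun y => by
    rw [Matrix.star_mulVec, hX.eq]
  have h2 : ∀ i, inner ℂ (sortedEigenvector hX i) (WithLp.toLp 2 (X.mulVec x.ofLp)) =
      hX.eigenvalues₀ i * inner ℂ (sortedEigenvector hX i) x := by
    intro i
    rw [EuclideanSpace.inner_eq_star_dotProduct, EuclideanSpace.inner_eq_star_dotProduct,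
      dotProduct_comm, Matrix.dotProduct_mulVec, h0, mulVec_sortedEigenvector, dotProduct_comm,
      star_smul, dotProduct_smul]
    simp
  rw [h1, ← (sortedEigenvector hX).sum_inner_mul_inner, Complex.re_sum]
  refine Finset.sum_congr rfl fun i _ => ?_
  rw [h2, ← inner_conj_symm x, mul_left_comm, mul_comm ((starRingEnd ℂ) _), Complex.mul_conj,
    Complex.normSq_eq_norm_sq, ← Complex.ofReal_mul, Complex.ofReal_re]

end KyFan

/-! ### Embedded coordinates and Ky Fan's maximum principle -/

section Embedding

variable {n b : Type} [Fintype n] [Fintype b]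

/-- Extension of a vector by zero along an injection of basis labels. -/
noncomputable def extendZero (ι : n → b) (g : EuclideanSpace ℂ n) : EuclideanSpace ℂ b :=
  WithLp.toLp 2 (Function.extend ι g.ofLp 0)

/-- Restriction of a vector to some of the basis labels. -/
noncomputable def restrict (ι : n → b) (x : EuclideanSpace ℂ b) : EuclideanSpace ℂ n :=
  WithLp.toLp 2 fun i => x (ι i)

theorem restrict_extendZero {n b : Type} {ι : n → b} (hι : Function.Injective ι)
    (g : EuclideanSpace ℂ n) :
    restrict ι (extendZero ι g) = g := by
  ext i
  simp [restrict, extendZero, hι.extend_apply]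

theorem inner_extendZero {ι : n → b} (hι : Function.Injective ι) (g : EuclideanSpace ℂ n)
    (x : EuclideanSpace ℂ b) : inner ℂ (extendZero ι g) x = inner ℂ g (restrict ι x) := by
  simp only [PiLp.inner_apply]
  symm
  refine Fintype.sum_of_injective ι hι _ _ (fun y hy => ?_) fun i => ?_
  · have : extendZero ι g y = 0 := by
      simp only [extendZero]
      rw [Function.extend_apply' _ _ _ (by simpa using hy)]
      rfl
    rw [this, inner_zero_left]
  · simp [restrict, extendZero, hι.extend_apply]

theorem norm_extendZero {ι : n → b} (hι : Function.Injective ι) (g : EuclideanSpace ℂ n) :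
    ‖extendZero ι g‖ = ‖g‖ := by
  rw [@norm_eq_sqrt_re_inner ℂ, @norm_eq_sqrt_re_inner ℂ, inner_extendZero hι,
    restrict_extendZero hι]

/-- Ky Fan's principle, for vectors of a larger space. The weight of an eigenvalue is the squared
length of the projection of its eigenvector to the span of `e`: at most one by Bessel, and at most
`d` in total because restriction does not increase norms. -/
theorem sum_quadForm_restrict_le [DecidableEq n] [DecidableEq b] {X : Matrix n n ℂ}
    (hX : X.PosSemidef) {ι : n → b}
    (hι : Function.Injective ι) {d k : ℕ} (hd : d ≤ k) {e : Fin d → EuclideanSpace ℂ b}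
    (he : Orthonormal ℂ e) :
    ∑ i, (star (restrict ι (e i)).ofLp ⬝ᵥ X.mulVec (restrict ι (e i)).ofLp).re ≤
      kyFan hX.isHermitian k := by
  have hH := hX.isHermitian
  simp only [re_quadForm_eq hH]
  rw [Finset.sum_comm, kyFan_eq_sum]
  simp only [← Finset.mul_sum]
  refine sum_antitone_weights_le (eigenvalues₀_nonneg hX) hH.eigenvalues₀_antitone
    (fun i => Finset.sum_nonneg fun j _ => sq_nonneg _) (fun i => ?_) ?_
  · simp only [← inner_extendZero hι, norm_inner_symm (extendZero ι _)]
    refine (he.sum_inner_products_le _).trans_eq ?_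
    rw [norm_extendZero hι, (sortedEigenvector hH).orthonormal.1, one_pow]
  · rw [Finset.sum_comm]
    simp only [OrthonormalBasis.sum_sq_norm_inner_right]
    have : ∀ j, ‖restrict ι (e j)‖ ^ 2 ≤ 1 := by
      intro j
      rw [EuclideanSpace.norm_sq_eq]
      have h1 : ‖e j‖ ^ 2 = 1 := by rw [he.1, one_pow]
      rw [EuclideanSpace.norm_sq_eq] at h1
      have h2 : ∑ i, ‖restrict ι (e j) i‖ ^ 2 = ∑ y ∈ Finset.univ.image ι, ‖e j y‖ ^ 2 := by
        rw [Finset.sum_image fun x _ y _ h => hι h]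
        rfl
      rw [← h1, h2]
      exact Finset.sum_le_univ_sum_of_nonneg fun y => sq_nonneg _
    calc ∑ j, ‖restrict ι (e j)‖ ^ 2 ≤ ∑ _j : Fin d, (1 : ℝ) := Finset.sum_le_sum fun j _ => this j
      _ = d := by simp
      _ ≤ k := by exact_mod_cast hd

end Embedding

/-! ### Overlap of a vector with vectors of bounded Schmidt rank -/

section SchmidtOverlap

variable {R a b n : Type} [Fintype R] [Fintype a] [Fintype b] [Fintype n]

/-- The reduced state of `v` on `b` is `X`, up to an embedding of the basis labels. -/
def ReducesTo (v : R × (a × b) → ℂ) (X : Matrix n n ℂ) (ι : n → b) : Prop :=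
  ∀ x : EuclideanSpace ℂ b, ∑ α, ‖inner ℂ x (slice v α)‖ ^ 2 =
    (star (restrict ι x).ofLp ⬝ᵥ X.mulVec (restrict ι x).ofLp).re

theorem dotProduct_eq_sum_inner_slice (χ φ : R × (a × b) → ℂ) :
    star χ ⬝ᵥ φ = ∑ α, inner ℂ (slice χ α) (slice φ α) := by
  simp only [dotProduct, Fintype.sum_prod_type, PiLp.inner_apply, slice]
  simp [mul_comm]

/-- Expanding the slices of `φ` in an orthonormal basis of the small space `s` and applying
Cauchy–Schwarz leaves the norm of `φ` times the weight of `v` on `s`, which Ky Fan's principle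
bounds. -/
theorem norm_sq_dotProduct_le [DecidableEq n] [DecidableEq b] {v : R × (a × b) → ℂ}
    {X : Matrix n n ℂ} (hX : X.PosSemidef)
    {ι : n → b} (hι : Function.Injective ι) (hv : ReducesTo v X ι) {k : ℕ} {φ : R × (a × b) → ℂ}
    (hφ : SchmidtLE k φ) :
    ‖star v ⬝ᵥ φ‖ ^ 2 ≤ kyFan hX.isHermitian k * (star φ ⬝ᵥ φ).re := by
  obtain ⟨s, hs, hφ⟩ := hφ
  let e := stdOrthonormalBasis ℂ s
  have he : Orthonormal ℂ fun i => (e i : EuclideanSpace ℂ b) :=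
    e.orthonormal.comp_linearIsometry s.subtypeₗᵢ
  have h1 : star v ⬝ᵥ φ = ∑ p : (R × a) × Fin (Module.finrank ℂ s),
        inner ℂ (slice v p.1) (e p.2 : EuclideanSpace ℂ b) *
      inner ℂ (e p.2 : EuclideanSpace ℂ b) (slice φ p.1) := by
    rw [dotProduct_eq_sum_inner_slice, Fintype.sum_prod_type (α₁ := R × a)]
    refine Finset.sum_congr rfl fun α _ => ?_
    have := congrArg (Subtype.val) (e.sum_repr' ⟨slice φ α, hφ α⟩)
    conv_lhs => rw [← Subtype.coe_mk (slice φ α) (hφ α), ← this]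
    simp only [Submodule.coe_sum, Submodule.coe_smul, inner_sum, inner_smul_right,
      Submodule.coe_inner]
    exact Finset.sum_congr rfl fun i _ => mul_comm _ _
  have h2 : (star φ ⬝ᵥ φ).re = ∑ p : (R × a) × Fin (Module.finrank ℂ s),
      ‖inner ℂ (e p.2 : EuclideanSpace ℂ b) (slice φ p.1)‖ ^ 2 := by
    rw [dotProduct_eq_sum_inner_slice, Fintype.sum_prod_type (α₁ := R × a), Complex.re_sum]
    refine Finset.sum_congr rfl fun α _ => ?_
    have := e.sum_sq_norm_inner_right ⟨slice φ α, hφ α⟩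
    simp only [Submodule.coe_inner] at this
    rw [this, ← inner_self_eq_norm_sq (𝕜 := ℂ)]
    rfl
  have h3 : ∑ p : (R × a) × Fin (Module.finrank ℂ s), ‖inner ℂ (slice v p.1) (e p.2 : EuclideanSpace ℂ b)‖ ^ 2 ≤
      kyFan hX.isHermitian k := by
    rw [Fintype.sum_prod_type, Finset.sum_comm]
    refine le_trans (le_of_eq ?_) (sum_quadForm_restrict_le hX hι hs he)
    refine Finset.sum_congr rfl fun i _ => ?_
    rw [← hv]
    exact Finset.sum_congr rfl fun α _ => by rw [norm_inner_symm]
  have h4 : ‖star v ⬝ᵥ φ‖ ≤ ∑ p : (R × a) × Fin (Module.finrank ℂ s),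
      ‖inner ℂ (slice v p.1) (e p.2 : EuclideanSpace ℂ b)‖ *
      ‖inner ℂ (e p.2 : EuclideanSpace ℂ b) (slice φ p.1)‖ := by
    rw [h1]
    refine (norm_sum_le _ _).trans_eq ?_
    simp only [norm_mul]
  calc ‖star v ⬝ᵥ φ‖ ^ 2 ≤ _ := pow_le_pow_left₀ (norm_nonneg _) h4 2
    _ ≤ _ := Finset.sum_mul_sq_le_sq_mul_sq _ _ _
    _ ≤ _ := by
      rw [← h2]
      refine mul_le_mul_of_nonneg_right h3 ?_
      rw [h2]
      exact Finset.sum_nonneg fun _ _ => sq_nonneg _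

/-- The witness is `(1 ⊗ P) v`, with `P` the projection to the top `k` embedded eigenvectors. As `P`
is a projection, both inner products equal the weight of `v` on its range. -/
theorem exists_schmidtLE_dotProduct_eq [DecidableEq n] [DecidableEq b] {v : R × (a × b) → ℂ}
    {X : Matrix n n ℂ}
    (hX : X.IsHermitian) {ι : n → b} (hι : Function.Injective ι) (hv : ReducesTo v X ι) (k : ℕ) :
    ∃ φ, SchmidtLE k φ ∧ star v ⬝ᵥ φ = (kyFan hX k : ℂ) ∧ star φ ⬝ᵥ φ = (kyFan hX k : ℂ) := by
  let e i := extendZero ι (sortedEigenvector hX i)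
  let S : Finset (Fin (Fintype.card n)) := Finset.univ.filter fun i => i.val < k
  have he : Orthonormal ℂ e := by
    refine ⟨fun i => ?_, fun i j hij => ?_⟩
    · rw [norm_extendZero hι, (sortedEigenvector hX).orthonormal.1]
    · change inner ℂ (extendZero ι _) _ = _
      rw [inner_extendZero hι, restrict_extendZero hι]
      exact (sortedEigenvector hX).orthonormal.2 hij
  let w : R × a → EuclideanSpace ℂ b := fun α => ∑ i ∈ S, inner ℂ (e i) (slice v α) • e i
  have hk : ∑ α, ∑ i ∈ S, ((‖inner ℂ (e i) (slice v α)‖ ^ 2 : ℝ) : ℂ) = (kyFan hX k : ℂ) := by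
    rw [kyFan_eq_sum, Finset.sum_comm, Complex.ofReal_sum]
    refine Finset.sum_congr rfl fun i _ => ?_
    rw [← Complex.ofReal_sum, hv (e i), restrict_extendZero hι, mulVec_sortedEigenvector,
      dotProduct_smul, dotProduct_comm, ← EuclideanSpace.inner_eq_star_dotProduct,
      inner_self_eq_norm_sq_to_K, (sortedEigenvector hX).orthonormal.1]
    simp
  refine ⟨fun p => w (p.1, p.2.1) p.2.2, ?_, ?_, ?_⟩
  · refine ⟨Submodule.span ℂ (S.image e : Set (EuclideanSpace ℂ b)), ?_, fun α => ?_⟩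
    · refine (finrank_span_finset_le_card _).trans (Finset.card_image_le.trans ?_)
      have : S.card = ((S.map Fin.valEmbedding).card) := by rw [Finset.card_map]
      rw [this]
      refine (Finset.card_le_card (t := Finset.range k) fun x hx => ?_).trans_eq
        (Finset.card_range k)
      simp only [S, Finset.mem_map, Finset.mem_filter] at hx
      obtain ⟨y, hy, rfl⟩ := hx
      simpa using hy.2
    · change w α ∈ _
      refine Submodule.sum_mem _ fun i hi => Submodule.smul_mem _ _ (Submodule.subset_span ?_)
      exact Finset.mem_coe.2 (Finset.mem_image_of_mem e hi)
  · rw [dotProduct_eq_sum_inner_slice, ← hk]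
    refine Finset.sum_congr rfl fun α _ => ?_
    change inner ℂ (slice v α) (w α) = _
    rw [inner_sum]
    refine Finset.sum_congr rfl fun i _ => ?_
    rw [inner_smul_right, ← inner_conj_symm (slice v α), Complex.mul_conj,
      Complex.normSq_eq_norm_sq]
  · rw [dotProduct_eq_sum_inner_slice, ← hk]
    refine Finset.sum_congr rfl fun α _ => ?_
    change inner ℂ (w α) (w α) = _
    rw [he.inner_sum]
    refine Finset.sum_congr rfl fun i _ => ?_
    rw [mul_comm, Complex.mul_conj, Complex.normSq_eq_norm_sq]

end SchmidtOverlap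

/-! ### Nielsen's inequality for pure-state transformations -/

section PureStateTransformation

variable {R a b a₁ b₁ : Type} [Fintype R] [Fintype a] [Fintype b] [Fintype a₁] [Fintype b₁]
  [DecidableEq R] [DecidableEq a] [DecidableEq b] [DecidableEq a₁] [DecidableEq b₁]

/-- The functional `X ↦ ⟨χ|X|χ⟩`. -/
noncomputable def expectation {n : Type} [Fintype n] (χ : n → ℂ) : Matrix n n ℂ →ₗ[ℂ] ℂ where
  toFun X := star χ ⬝ᵥ X.mulVec χ
  map_add' X Y := by rw [Matrix.add_mulVec, dotProduct_add]
  map_smul' c X := by rw [Matrix.smul_mulVec, dotProduct_smul]; rfl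

theorem re_expectation_pureOp {n : Type} [Fintype n] (χ φ : n → ℂ) :
    (expectation χ (pureOp φ)).re = ‖star χ ⬝ᵥ φ‖ ^ 2 := by
  change (star χ ⬝ᵥ (Matrix.vecMulVec φ (star φ)).mulVec χ).re = _
  have h : star φ ⬝ᵥ χ = star (star χ ⬝ᵥ φ) := Matrix.star_dotProduct _ _
  rw [Matrix.vecMulVec_mulVec, h, dotProduct_smul]
  simp only [MulOpposite.smul_eq_mul_unop, MulOpposite.unop_op, Complex.star_def]
  rw [Complex.mul_conj, Complex.normSq_eq_norm_sq, Complex.ofReal_re]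

theorem trace_pureOp {n : Type} [Fintype n] (φ : n → ℂ) : (pureOp φ).trace = star φ ⬝ᵥ φ := by
  rw [pureOp, Matrix.trace_vecMulVec, dotProduct_comm]

theorem norm_sq_dotProduct_le_mul {n : Type} [Fintype n] (χ φ : n → ℂ) :
    ‖star χ ⬝ᵥ φ‖ ^ 2 ≤ (star χ ⬝ᵥ χ).re * (star φ ⬝ᵥ φ).re := by
  have h1 : ∀ x y : n → ℂ, star x ⬝ᵥ y =
      inner ℂ (WithLp.toLp 2 x : EuclideanSpace ℂ n) (WithLp.toLp 2 y) := fun x y => by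
    rw [EuclideanSpace.inner_eq_star_dotProduct, dotProduct_comm]
  have h2 : ∀ x : n → ℂ, (star x ⬝ᵥ x).re = ‖(WithLp.toLp 2 x : EuclideanSpace ℂ n)‖ ^ 2 := by
    intro x
    rw [h1, ← inner_self_eq_norm_sq (𝕜 := ℂ)]
    rfl
  rw [h2, h2, h1, ← mul_pow]
  exact pow_le_pow_left₀ (norm_nonneg _) (norm_inner_le_norm _ _) 2

theorem pureOp_add_smul {n : Type} (v φ : n → ℂ) (t : ℝ) :
    pureOp (v + (t : ℂ) • φ) = pureOp v +
      (t : ℂ) • (Matrix.vecMulVec v (star φ) + Matrix.vecMulVec φ (star v)) +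
      ((t ^ 2 : ℝ) : ℂ) • pureOp φ := by
  ext i j
  simp [pureOp, Matrix.vecMulVec_apply]
  ring

/-- The two sides of `h1` agree at `t = 0`, so their linear terms coincide and `G = 2 s`; then the
discriminant of the nonnegative quadratic in `h0` gives the claim. -/
theorem sq_le_of_quadratic_bounds {s q G : ℝ} (h0 : ∀ t : ℝ, 0 ≤ 1 + t * G + t ^ 2 * q)
    (h1 : ∀ t : ℝ, 1 + t * G + t ^ 2 * q ≤ 1 + t * (2 * s) + t ^ 2 * s) : s ^ 2 ≤ q := by
  have hd := discrim_le_zero (a := s - q) (b := 2 * s - G) (c := 0)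
    fun t => by nlinarith [h1 t]
  have hG : 2 * s - G = 0 := by
    rw [discrim] at hd
    nlinarith [sq_nonneg (2 * s - G)]
  have hd' := discrim_le_zero (a := q) (b := G) (c := 1) fun t => by nlinarith [h0 t]
  rw [discrim] at hd'
  have : G = 2 * s := by linarith
  rw [this] at hd'
  nlinarith

/-- Nielsen's inequality: an LOCC transformation between pure states increases all the Ky Fan sums of
the reduced state. -/
theorem IsLOCC.kyFan_le {M : SuperOp (a × b) (a₁ × b₁)} (hM : IsLOCC M) {v : R × (a × b) → ℂ}
    {χ : R × (a₁ × b₁) → ℂ} (hv : star v ⬝ᵥ v = 1)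
    (h : tensorMap (LinearMap.id : SuperOp R R) M (pureOp v) = pureOp χ) {n m : Type} [Fintype n]
    [Fintype m] [DecidableEq n] [DecidableEq m] {X : Matrix n n ℂ} {Y : Matrix m m ℂ}
    (hX : X.PosSemidef) (hY : Y.PosSemidef) {ι : n → b} {κ : m → b₁} (hι : Function.Injective ι)
    (hκ : Function.Injective κ) (hvX : ReducesTo v X ι) (hχY : ReducesTo χ Y κ) (k : ℕ) :
    kyFan hX.isHermitian k ≤ kyFan hY.isHermitian k := by
  obtain ⟨hP, hT⟩ := hM.preservesSchmidt (R := R)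
  set Λ := tensorMap (LinearMap.id : SuperOp R R) M
  -- At `k = card b` the rank restriction on the input is void, so this cone stands in for all
  -- positive operators.
  have hmem : ∀ x : R × (a × b) → ℂ, pureOp x ∈ schmidtCone R a b (Fintype.card b) :=
    fun x => pureOp_mem_schmidtCone (schmidtLE_card x)
  have hχ : (star χ ⬝ᵥ χ).re = 1 := by
    rw [← trace_pureOp, ← h, hT _ _ (hmem v), trace_pureOp, hv, Complex.one_re]
  obtain ⟨φ, hφ, hvφ, hφφ⟩ := exists_schmidtLE_dotProduct_eq hX.isHermitian hι hvX k
  set s := kyFan hX.isHermitian k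
  set S := kyFan hY.isHermitian k
  have hs : 0 ≤ s := kyFan_nonneg hX k
  have hS : 0 ≤ S := kyFan_nonneg hY k
  let g := expectation χ ∘ₗ Λ
  have h0 : ∀ x, 0 ≤ (g (pureOp x)).re := fun x => by
    refine hP _ _ (hmem x) (expectation χ) fun y _ => ?_
    rw [re_expectation_pureOp]
    exact sq_nonneg _
  have h1 : ∀ x, (g (pureOp x)).re ≤ (pureOp x).trace.re := fun x => by
    have := hP _ _ (hmem x) (Matrix.traceLinearMap _ ℂ ℂ - expectation χ) fun y _ => by
      rw [LinearMap.sub_apply, Complex.sub_re, re_expectation_pureOp, Matrix.traceLinearMap_apply,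
        trace_pureOp]
      have := norm_sq_dotProduct_le_mul χ y
      rw [hχ, one_mul] at this
      linarith
    rw [LinearMap.sub_apply, Complex.sub_re, Matrix.traceLinearMap_apply, hT _ _ (hmem x)] at this
    exact sub_nonneg.1 this
  -- By the overlap bound, `S · tr - ⟨χ|·|χ⟩` is nonnegative on vectors of Schmidt rank at most `k`,
  -- hence on the image of `φ`, whose trace is `s`.
  have h2 : (g (pureOp φ)).re ≤ S * s := by
    have := hP _ _ (pureOp_mem_schmidtCone hφ)
      ((S : ℂ) • Matrix.traceLinearMap _ ℂ ℂ - expectation χ) fun y hy => by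
        rw [LinearMap.sub_apply, Complex.sub_re, re_expectation_pureOp, LinearMap.smul_apply,
          Matrix.traceLinearMap_apply, trace_pureOp, smul_eq_mul, Complex.re_ofReal_mul]
        exact sub_nonneg.2 (norm_sq_dotProduct_le hY hκ hχY hy)
    rw [LinearMap.sub_apply, Complex.sub_re, LinearMap.smul_apply, Matrix.traceLinearMap_apply,
      smul_eq_mul, Complex.re_ofReal_mul, hT _ _ (pureOp_mem_schmidtCone hφ), trace_pureOp, hφφ,
      Complex.ofReal_re] at this
    exact sub_nonneg.1 this
  have h3 : (g (pureOp v)).re = 1 := by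
    change (expectation χ (Λ (pureOp v))).re = 1
    rw [h, re_expectation_pureOp]
    have : star χ ⬝ᵥ χ = 1 :=
      Complex.ext hχ (Complex.le_def.1 (dotProduct_star_self_nonneg χ)).2.symm
    rw [this, norm_one, one_pow]
  set c := Matrix.vecMulVec v (star φ) + Matrix.vecMulVec φ (star v)
  have hc : c.trace.re = 2 * s := by
    have h4 : star φ ⬝ᵥ v = (s : ℂ) := by
      have : star φ ⬝ᵥ v = star (star v ⬝ᵥ φ) := Matrix.star_dotProduct _ _
      rw [this, hvφ, Complex.star_def, Complex.conj_ofReal]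
    rw [Matrix.trace_add, Matrix.trace_vecMulVec, Matrix.trace_vecMulVec, dotProduct_comm v,
      dotProduct_comm φ, h4, hvφ, Complex.add_re, Complex.ofReal_re]
    ring
  -- Positivity and trace domination of `g` on `v + tφ` for all real `t`, with `g = 1` at `t = 0`,
  -- are the two quadratic bounds.
  have key : s ^ 2 ≤ (g (pureOp φ)).re := by
    refine sq_le_of_quadratic_bounds (G := (g c).re) (fun t => ?_) fun t => ?_
    · have := h0 (v + (t : ℂ) • φ)
      rwa [pureOp_add_smul, map_add, map_add, map_smul, map_smul, smul_eq_mul, smul_eq_mul,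
        Complex.add_re, Complex.add_re, Complex.re_ofReal_mul, Complex.re_ofReal_mul, h3] at this
    · have := h1 (v + (t : ℂ) • φ)
      rwa [pureOp_add_smul, map_add, map_add, map_smul, map_smul, smul_eq_mul, smul_eq_mul,
        Complex.add_re, Complex.add_re, Complex.re_ofReal_mul, Complex.re_ofReal_mul, h3,
        Matrix.trace_add, Matrix.trace_add, Matrix.trace_smul, Matrix.trace_smul, smul_eq_mul,
        smul_eq_mul, Complex.add_re, Complex.add_re, Complex.re_ofReal_mul, Complex.re_ofReal_mul,
        hc, trace_pureOp, trace_pureOp, hv, hφφ, Complex.one_re, Complex.ofReal_re] at this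
  rcases hs.eq_or_lt with hs0 | hs0
  · rwa [← hs0]
  · nlinarith

end PureStateTransformation

/-! ### Reduced states as mixtures, and the maximally entangled factor -/

section ReducedStates

/-- The operator `∑ i, |η i⟩⟨η i|`. -/
noncomputable def mixture {s c : Type} [Fintype s] (η : s → c → ℂ) : Matrix c c ℂ :=
  ∑ i, pureOp (η i)

theorem mixture_posSemidef {s c : Type} [Fintype s] [Fintype c] (η : s → c → ℂ) :
    (mixture η).PosSemidef :=
  Matrix.posSemidef_sum _ fun i _ => Matrix.posSemidef_vecMulVec_self_star (η i)

theorem quadForm_mixture {s c : Type} [Fintype s] [Fintype c] (η : s → c → ℂ) (x : c → ℂ) :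
    (star x ⬝ᵥ (mixture η).mulVec x).re = ∑ i, ‖star x ⬝ᵥ η i‖ ^ 2 := by
  change (expectation x (mixture η)).re = _
  rw [mixture, map_sum, Complex.re_sum]
  simp only [re_expectation_pureOp]

theorem maxMixed_posSemidef (K : ℕ) : (maxMixed K).PosSemidef :=
  Matrix.PosSemidef.one.smul (by
    rw [← Complex.ofReal_natCast, ← Complex.ofReal_inv]
    exact Complex.zero_le_real.2 (by positivity))

theorem trace_maxMixed {K : ℕ} (hK : 1 ≤ K) : (maxMixed K).trace = 1 := by
  have : (K : ℂ) ≠ 0 := by exact_mod_cast (by omega : K ≠ 0)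
  simp [maxMixed, Matrix.trace_smul, this]

theorem re_quadForm_maxMixed_kronecker {c : Type} [Fintype c] (K : ℕ) (ρ : Matrix c c ℂ)
    (x : Fin K × c → ℂ) :
    (star x ⬝ᵥ (maxMixed K ⊗ₖ ρ).mulVec x).re =
      ∑ l, (K : ℝ)⁻¹ *
        (star (fun y => x (l, y)) ⬝ᵥ ρ.mulVec fun y => x (l, y)).re := by
  have h : ∀ l y, (maxMixed K ⊗ₖ ρ).mulVec x (l, y) =
      ((K : ℝ)⁻¹ : ℝ) * ρ.mulVec (fun y => x (l, y)) y := by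
    intro l y
    simp only [Matrix.mulVec, dotProduct, Fintype.sum_prod_type,
    Matrix.kroneckerMap_apply, maxMixed,
      Matrix.smul_apply, Matrix.one_apply, smul_eq_mul]
    rw [Finset.sum_eq_single l]
    · simp [Finset.mul_sum, mul_assoc]
    · intro j _ hj
      simp [Ne.symm hj]
    · simp
  simp only [dotProduct, Fintype.sum_prod_type, h, Pi.star_apply]
  rw [Complex.re_sum]
  refine Finset.sum_congr rfl fun l _ => ?_
  rw [← Complex.re_ofReal_mul, Finset.mul_sum]
  congr 1
  exact Finset.sum_congr rfl fun y _ => mul_left_comm _ _ _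

/-- Tracing out one half of `Φ_K` leaves `𝟙_K/K` on the first `K` of the `q` labels. Only labels `j
< K` contribute, each with weight `1/K`. -/
theorem sum_norm_inner_maxEnt {s c : Type} [Fintype s] [Fintype c] (η : s → c → ℂ) {K p q : ℕ}
    (hp : K ≤ p) (hq : K ≤ q) (x : EuclideanSpace ℂ (c × Fin q)) :
    ∑ i, ∑ j, ‖inner ℂ x (WithLp.toLp 2 fun y : c × Fin q => η i y.1 * maxEnt K p q (j, y.2))‖ ^ 2 =
      (star (restrict (fun y : Fin K × c => (y.2, Fin.castLE hq y.1)) x).ofLp ⬝ᵥ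
        (maxMixed K ⊗ₖ mixture η).mulVec
          (restrict (fun y : Fin K × c => (y.2, Fin.castLE hq y.1)) x).ofLp).re := by
  rw [re_quadForm_maxMixed_kronecker]
  simp only [quadForm_mixture, Finset.mul_sum]
  rw [Finset.sum_comm (γ := Fin K)]
  refine Finset.sum_congr rfl fun i _ => ?_
  symm
  refine Fintype.sum_of_injective (Fin.castLE hp) (Fin.castLE_injective hp) _ _ (fun j hj => ?_)
    fun l => ?_
  · have hj' : ¬ j.val < K := fun h => hj ⟨⟨j, h⟩, rfl⟩
    simp [PiLp.inner_apply, maxEnt, hj']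
  · have hn : ‖(((Real.sqrt K : ℝ) : ℂ))⁻¹‖ ^ 2 = (K : ℝ)⁻¹ := by
      rw [norm_inv, Complex.norm_real, inv_pow, Real.norm_eq_abs, sq_abs,
        Real.sq_sqrt (by positivity)]
    rw [← hn, ← mul_pow, ← norm_mul]
    congr 2
    simp only [PiLp.inner_apply, dotProduct, Fintype.sum_prod_type, Finset.mul_sum]
    refine Finset.sum_congr rfl fun y _ => ?_
    rw [Finset.sum_eq_single (Fin.castLE hq l)]
    · simp [maxEnt, restrict]
      ring
    · intro j _ hj
      have : ¬ (l : ℕ) = j := fun h => hj (Fin.ext h.symm)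
      simp [maxEnt, this]
    · simp

end ReducedStates

/-! ### Majorization from eigenvalue bounds -/

section MajorizationBounds

variable {n m : Type} [Fintype n] [Fintype m] [DecidableEq n] [DecidableEq m]

theorem majorized_of_kyFan_le {X : Matrix n n ℂ} {Y : Matrix m m ℂ} (hX : X.PosSemidef)
    (hY : Y.PosSemidef) (hXt : X.trace = 1) (hYt : Y.trace = 1)
    (h : ∀ k, kyFan hX.isHermitian k ≤ kyFan hY.isHermitian k) : Majorized X Y :=
  ⟨hX, hY, h, by rw [sum_eigenvalues₀, sum_eigenvalues₀, hXt, hYt]⟩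

theorem kyFan_of_card_le {X : Matrix n n ℂ} (hX : X.IsHermitian) {k : ℕ}
    (hk : Fintype.card n ≤ k) : kyFan hX k = X.trace.re := by
  rw [kyFan_eq_sum, ← sum_eigenvalues₀ hX, Finset.filter_true_of_mem]
  intro i _
  omega

theorem kyFan_le_trace {X : Matrix n n ℂ} (hX : X.PosSemidef) (k : ℕ) :
    kyFan hX.isHermitian k ≤ X.trace.re := by
  rw [kyFan_eq_sum, ← sum_eigenvalues₀ hX.isHermitian]
  exact Finset.sum_le_univ_sum_of_nonneg (eigenvalues₀_nonneg hX)

theorem kyFan_le_mul {X : Matrix n n ℂ} (hX : X.IsHermitian) {μ : ℝ} (hμ : 0 ≤ μ)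
    (h : ∀ i, hX.eigenvalues₀ i ≤ μ) (k : ℕ) : kyFan hX k ≤ k * μ := by
  have : ∀ i ∈ Finset.range k, sortedEigenvalue hX i ≤ μ := by
    intro i _
    rw [sortedEigenvalue]
    split_ifs
    · exact h _
    · exact hμ
  refine (Finset.sum_le_card_nsmul _ _ _ this).trans_eq ?_
  simp

theorem div_mul_trace_le_kyFan {Y : Matrix m m ℂ} (hY : Y.PosSemidef) {k : ℕ}
    (hk : k ≤ Fintype.card m) :
    Y.trace.re * (k / Fintype.card m) ≤ kyFan hY.isHermitian k := by
  rw [← sum_eigenvalues₀ hY.isHermitian, kyFan_eq_sum, Finset.sum_mul]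
  have hk' : (k : ℝ) ≤ Fintype.card m := by exact_mod_cast hk
  refine sum_antitone_weights_le (eigenvalues₀_nonneg hY) hY.isHermitian.eigenvalues₀_antitone
    (fun _ => by positivity) (fun _ => div_le_one_of_le₀ hk' (by positivity)) ?_
  simp only [Finset.sum_const, Finset.card_univ, Fintype.card_fin, nsmul_eq_mul]
  rcases (Nat.cast_nonneg (α := ℝ) (Fintype.card m)).eq_or_lt with h0 | h0
  · rw [← h0, zero_mul]
    positivity
  · rw [mul_div_cancel₀ _ h0.ne']

/-- The `k` largest of `card m` eigenvalues with sum one have sum at least `k / card m`, whatever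
the state `Y`. -/
theorem majorized_of_eigenvalues₀_le {X : Matrix n n ℂ} {Y : Matrix m m ℂ} (hX : X.PosSemidef)
    (hY : Y.PosSemidef) (hXt : X.trace = 1) (hYt : Y.trace = 1)
    (h : ∀ i, hX.isHermitian.eigenvalues₀ i ≤ (Fintype.card m : ℝ)⁻¹) : Majorized X Y := by
  refine majorized_of_kyFan_le hX hY hXt hYt fun k => ?_
  rcases le_total k (Fintype.card m) with hk | hk
  · have h1 := div_mul_trace_le_kyFan hY hk
    rw [hYt, Complex.one_re, one_mul, div_eq_mul_inv] at h1
    exact (kyFan_le_mul hX.isHermitian (by positivity) h k).trans h1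
  · rw [kyFan_of_card_le hY.isHermitian hk, hYt, ← hXt]
    exact kyFan_le_trace hX k

theorem eigenvalues₀_eq_quadForm {X : Matrix n n ℂ} (hX : X.IsHermitian)
    (i : Fin (Fintype.card n)) : hX.eigenvalues₀ i =
      (star (sortedEigenvector hX i).ofLp ⬝ᵥ X.mulVec (sortedEigenvector hX i).ofLp).re := by
  rw [mulVec_sortedEigenvector, dotProduct_smul, dotProduct_comm,
    ← EuclideanSpace.inner_eq_star_dotProduct, inner_self_eq_norm_sq_to_K,
    (sortedEigenvector hX).orthonormal.1]
  simp

theorem trace_mixture {s c : Type} [Fintype s] [Fintype c] (η : s → c → ℂ) :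
    (mixture η).trace = ∑ i, star (η i) ⬝ᵥ η i := by
  rw [mixture, Matrix.trace_sum]
  simp only [trace_pureOp]

/-- A trace-one mixture has quadratic form at most the squared norm, by Cauchy–Schwarz on each
component; the tensor factor scales this by `1/K`. -/
theorem eigenvalues₀_maxMixed_kronecker_le {s c : Type} [Fintype s] [Fintype c] [DecidableEq c]
    (η : s → c → ℂ) (h : (mixture η).trace = 1) {K : ℕ}
    (hX : (maxMixed K ⊗ₖ mixture η).IsHermitian) (i : Fin (Fintype.card (Fin K × c))) :
    hX.eigenvalues₀ i ≤ (K : ℝ)⁻¹ := by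
  rw [eigenvalues₀_eq_quadForm, re_quadForm_maxMixed_kronecker, ← Finset.mul_sum]
  refine mul_le_of_le_one_right (by positivity) ?_
  have h1 : ∑ i, (star (η i) ⬝ᵥ η i).re = 1 := by
    rw [← Complex.re_sum, ← trace_mixture, h, Complex.one_re]
  set x := sortedEigenvector hX i
  have h2 : ∑ l : Fin K, (star (fun y => x (l, y)) ⬝ᵥ fun y => x (l, y)).re = 1 := by
    have h3 : star x.ofLp ⬝ᵥ x.ofLp = 1 := by
      rw [dotProduct_comm, ← EuclideanSpace.inner_eq_star_dotProduct, inner_self_eq_norm_sq_to_K,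
        (sortedEigenvector hX).orthonormal.1]
      simp
    rw [← Complex.one_re, ← h3, dotProduct, Fintype.sum_prod_type, Complex.re_sum]
    rfl
  calc _ ≤ ∑ l : Fin K, (star (fun y => x (l, y)) ⬝ᵥ fun y => x (l, y)).re := by
        refine Finset.sum_le_sum fun l _ => ?_
        rw [quadForm_mixture]
        refine (Finset.sum_le_sum fun i _ => norm_sq_dotProduct_le_mul _ (η i)).trans_eq ?_
        rw [← Finset.mul_sum, h1, mul_one]
    _ = 1 := h2
    _ ≤ 1 := le_rfl

end MajorizationBounds

/-! ### Reduced states of the merging problem and the cost sets -/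

section Merging

variable {R A B : Type} [Fintype R] [Fintype A] [Fintype B]

theorem reducedAB_eq_mixture {R A B : Type} [Fintype R] (ψ : EuclideanSpace ℂ (R × A × B)) :
    reducedAB ψ = mixture fun r y => ψ (r, y) := by
  ext i j
  simp [reducedAB, mixture, ptraceFst, Matrix.sum_apply, pureOp, Matrix.vecMulVec_apply]

theorem reducedB_eq_mixture {R A B : Type} [Fintype R] [Fintype A]
    (ψ : EuclideanSpace ℂ (R × A × B)) :
    reducedB ψ = mixture fun (s : R × A) y => ψ (s.1, s.2, y) := by
  ext i j
  simp [reducedB, reducedAB, mixture, ptraceFst, Matrix.sum_apply, pureOp, Matrix.vecMulVec_apply,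
    Fintype.sum_prod_type]
  exact Finset.sum_comm

theorem trace_reducedAB {ψ : EuclideanSpace ℂ (R × A × B)} (hψ : ‖ψ‖ = 1) :
    (reducedAB ψ).trace = 1 := by
  rw [reducedAB, trace_ptraceFst, trace_pureOp, dotProduct_comm]
  refine (EuclideanSpace.inner_eq_star_dotProduct ψ ψ).symm.trans ?_
  rw [inner_self_eq_norm_sq_to_K, hψ]
  simp

theorem trace_reducedB {ψ : EuclideanSpace ℂ (R × A × B)} (hψ : ‖ψ‖ = 1) :
    (reducedB ψ).trace = 1 := by
  rw [reducedB, trace_ptraceFst, trace_reducedAB hψ]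

theorem reducedAB_posSemidef (ψ : EuclideanSpace ℂ (R × A × B)) : (reducedAB ψ).PosSemidef := by
  rw [reducedAB_eq_mixture]
  exact mixture_posSemidef _

theorem reducedB_posSemidef (ψ : EuclideanSpace ℂ (R × A × B)) : (reducedB ψ).PosSemidef := by
  rw [reducedB_eq_mixture]
  exact mixture_posSemidef _

theorem trace_maxMixed_kronecker {c : Type} [Fintype c] {K : ℕ} (hK : 1 ≤ K) {ρ : Matrix c c ℂ}
    (h : ρ.trace = 1) : (maxMixed K ⊗ₖ ρ).trace = 1 := by
  rw [Matrix.trace_kronecker, trace_maxMixed hK, h, one_mul]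

theorem reducesTo_mergingInput (ψ : EuclideanSpace ℂ (R × A × B)) {K p q : ℕ} (hp : K ≤ p)
    (hq : K ≤ q) : ReducesTo (mergingInput ψ K p q) (maxMixed K ⊗ₖ reducedB ψ)
      fun y : Fin K × B => (y.2, Fin.castLE hq y.1) := by
  intro x
  rw [reducedB_eq_mixture, ← sum_norm_inner_maxEnt _ hp hq]
  simp only [Fintype.sum_prod_type]
  rfl

theorem reducesTo_mergingOutput (ψ : EuclideanSpace ℂ (R × A × B)) {L p q : ℕ} (hp : L ≤ p)
    (hq : L ≤ q) : ReducesTo (mergingOutput ψ L p q) (maxMixed L ⊗ₖ reducedAB ψ)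
      fun y : Fin L × (A × B) => (y.2, Fin.castLE hq y.1) := by
  intro x
  rw [reducedAB_eq_mixture, ← sum_norm_inner_maxEnt _ hp hq]
  simp only [Fintype.sum_prod_type]
  rfl

/-- Embedding `A × B` at resource label `0` gives the non-catalytic bound directly for `ψ^{AB}`,
without comparing its spectrum with that of `𝟙_1 ⊗ ψ^{AB}`. -/
theorem reducesTo_mergingOutput_one (ψ : EuclideanSpace ℂ (R × A × B)) {p q : ℕ} (hp : 1 ≤ p)
    (hq : 1 ≤ q) : ReducesTo (mergingOutput ψ 1 p q) (reducedAB ψ)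
      fun y : A × B => (y, Fin.castLE hq 0) := by
  intro x
  rw [reducesTo_mergingOutput ψ hp hq x, re_quadForm_maxMixed_kronecker]
  simp [restrict]

theorem injective_prod_castLE {c : Type} {K q : ℕ} (hq : K ≤ q) :
    Function.Injective fun y : Fin K × c => (y.2, Fin.castLE hq y.1) := by
  rintro ⟨i, x⟩ ⟨j, y⟩ h
  simp only [Prod.mk.injEq] at h
  exact Prod.ext (Fin.castLE_injective hq h.2) h.1

theorem sum_maxEnt {K p q : ℕ} (hK : 1 ≤ K) (hp : K ≤ p) (hq : K ≤ q) :
    star (maxEnt K p q) ⬝ᵥ maxEnt K p q = 1 := by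
  have hn : star (((Real.sqrt K : ℝ) : ℂ))⁻¹ * (((Real.sqrt K : ℝ) : ℂ))⁻¹ = (K : ℂ)⁻¹ := by
    rw [Complex.star_def, map_inv₀, Complex.conj_ofReal, ← mul_inv, ← Complex.ofReal_mul,
      Real.mul_self_sqrt (by positivity), Complex.ofReal_natCast]
  have h0 : (K : ℂ) ≠ 0 := by exact_mod_cast (by omega : K ≠ 0)
  have h1 : ∑ _l : Fin K, (K : ℂ)⁻¹ = 1 := by simp [h0]
  rw [dotProduct, ← h1]
  symm
  refine Fintype.sum_of_injective (fun l => (Fin.castLE hp l, Fin.castLE hq l))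
    (fun i j h => Fin.castLE_injective hp (Prod.ext_iff.1 h).1) _ _ (fun y hy => ?_) fun l => ?_
  · have : ¬ (y.1.val = y.2.val ∧ y.1.val < K) := fun h =>
      hy ⟨⟨y.1, h.2⟩, Prod.ext rfl (Fin.ext h.1)⟩
    simp [maxEnt, this]
  · rw [← hn]
    simp [maxEnt]

theorem mergingInput_dotProduct_self {ψ : EuclideanSpace ℂ (R × A × B)} (hψ : ‖ψ‖ = 1)
    {K p q : ℕ} (hK : 1 ≤ K) (hp : K ≤ p) (hq : K ≤ q) :
    star (mergingInput ψ K p q) ⬝ᵥ mergingInput ψ K p q = 1 := by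
  let e : R × ((A × Fin p) × (B × Fin q)) ≃ (R × A × B) × (Fin p × Fin q) :=
    { toFun := fun i => ((i.1, i.2.1.1, i.2.2.1), (i.2.1.2, i.2.2.2))
      invFun := fun i => (i.1.1, ((i.1.2.1, i.2.1), (i.1.2.2, i.2.2)))
      left_inv := fun _ => rfl
      right_inv := fun _ => rfl }
  have h1 : star ψ.ofLp ⬝ᵥ ψ.ofLp = 1 := by
    rw [dotProduct_comm, ← EuclideanSpace.inner_eq_star_dotProduct, inner_self_eq_norm_sq_to_K, hψ]
    simp
  have h2 : star (mergingInput ψ K p q) ⬝ᵥ mergingInput ψ K p q =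
      (star ψ.ofLp ⬝ᵥ ψ.ofLp) * (star (maxEnt K p q) ⬝ᵥ maxEnt K p q) := by
    simp only [dotProduct]
    rw [Finset.sum_mul_sum, ← Fintype.sum_prod_type', ← Equiv.sum_comp e]
    refine Finset.sum_congr rfl fun i _ => ?_
    simp only [mergingInput, Pi.star_apply, star_mul', e, Equiv.coe_fn_mk]
    ring
  rw [h2, h1, sum_maxEnt hK hp hq, one_mul]

theorem majorized_maxMixed_card [DecidableEq B] {ψ : EuclideanSpace ℂ (R × A × B)} (hψ : ‖ψ‖ = 1)
    {m : Type}
    [Fintype m] [DecidableEq m] {Y : Matrix m m ℂ} (hY : Y.PosSemidef) (hYt : Y.trace = 1) :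
    1 ≤ Fintype.card m ∧ Majorized (maxMixed (Fintype.card m) ⊗ₖ reducedB ψ) Y := by
  have hm : 1 ≤ Fintype.card m := by
    by_contra! h
    have : IsEmpty m := Fintype.card_eq_zero_iff.1 (by omega)
    simp [Matrix.trace] at hYt
  have hX := (maxMixed_posSemidef (Fintype.card m)).kronecker (reducedB_posSemidef ψ)
  have hB := trace_reducedB hψ
  refine ⟨hm, majorized_of_eigenvalues₀_le hX hY (trace_maxMixed_kronecker hm hB) hYt ?_⟩
  revert hX hB
  rw [reducedB_eq_mixture]
  exact fun hX hB i => eigenvalues₀_maxMixed_kronecker_le _ hB hX.isHermitian i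

/-- The left state lives in dimension `K · dim B`, so that many eigenvalues of the right state must
already sum to one, while each is at most `1/L`. -/
theorem le_mul_card_of_majorized [DecidableEq A] [DecidableEq B]
    {ψ : EuclideanSpace ℂ (R × A × B)} (hψ : ‖ψ‖ = 1) {K L : ℕ}
    (hK : 1 ≤ K) (hL : 1 ≤ L)
    (h : Majorized (maxMixed K ⊗ₖ reducedB ψ) (maxMixed L ⊗ₖ reducedAB ψ)) :
    L ≤ K * Fintype.card B := by
  obtain ⟨hX, hY, h, -⟩ := h
  have h1 : kyFan hX.isHermitian (K * Fintype.card B) = 1 := by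
    rw [kyFan_of_card_le _ (by simp), trace_maxMixed_kronecker hK (trace_reducedB hψ),
      Complex.one_re]
  have h2 : kyFan hY.isHermitian (K * Fintype.card B) ≤
      (K * Fintype.card B : ℕ) * (L : ℝ)⁻¹ := by
    refine kyFan_le_mul _ (by positivity) ?_ _
    have hAB := trace_reducedAB hψ
    clear h
    revert hY hAB
    rw [reducedAB_eq_mixture]
    exact fun hY hAB i => eigenvalues₀_maxMixed_kronecker_le _ hAB hY.isHermitian i
  have h3 := (h1.symm.le.trans (h _)).trans h2
  have hL' : (0 : ℝ) < L := by exact_mod_cast hL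
  rw [← div_eq_mul_inv, le_div_iff₀ hL', one_mul] at h3
  exact_mod_cast h3

variable [DecidableEq R] [DecidableEq A] [DecidableEq B]

theorem IsExactMerging.majorized {ψ : EuclideanSpace ℂ (R × A × B)} (hψ : ‖ψ‖ = 1)
    {K L p q : ℕ} {M : SuperOp ((A × Fin p) × (B × Fin q)) (Fin p × ((A × B) × Fin q))}
    (h : IsExactMerging ψ K L M) :
    Majorized (maxMixed K ⊗ₖ reducedB ψ) (maxMixed L ⊗ₖ reducedAB ψ) := by
  have hX := (maxMixed_posSemidef K).kronecker (reducedB_posSemidef ψ)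
  have hY := (maxMixed_posSemidef L).kronecker (reducedAB_posSemidef ψ)
  exact majorized_of_kyFan_le hX hY (trace_maxMixed_kronecker h.one_le_K (trace_reducedB hψ))
    (trace_maxMixed_kronecker h.one_le_L (trace_reducedAB hψ)) fun k =>
      h.locc.kyFan_le (mergingInput_dotProduct_self hψ h.one_le_K h.K_le.1 h.K_le.2) h.achieves hX hY
        (injective_prod_castLE h.K_le.2) (injective_prod_castLE h.L_le.2)
        (reducesTo_mergingInput ψ h.K_le.1 h.K_le.2)
        (reducesTo_mergingOutput ψ h.L_le.1 h.L_le.2) k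

theorem IsExactMerging.majorized_of_nonCatalytic {ψ : EuclideanSpace ℂ (R × A × B)} (hψ : ‖ψ‖ = 1)
    {K p q : ℕ} {M : SuperOp ((A × Fin p) × (B × Fin q)) (Fin p × ((A × B) × Fin q))}
    (h : IsExactMerging ψ K 1 M) : Majorized (maxMixed K ⊗ₖ reducedB ψ) (reducedAB ψ) := by
  have hX := (maxMixed_posSemidef K).kronecker (reducedB_posSemidef ψ)
  have hY := reducedAB_posSemidef ψ
  exact majorized_of_kyFan_le hX hY (trace_maxMixed_kronecker h.one_le_K (trace_reducedB hψ))
    (trace_reducedAB hψ) fun k =>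
      h.locc.kyFan_le (mergingInput_dotProduct_self hψ h.one_le_K h.K_le.1 h.K_le.2) h.achieves hX hY
        (injective_prod_castLE h.K_le.2) (fun _ _ e => (Prod.ext_iff.1 e).1)
        (reducesTo_mergingInput ψ h.K_le.1 h.K_le.2)
        (reducesTo_mergingOutput_one ψ h.L_le.1 h.L_le.2) k

theorem bddBelow_catalyticCosts {ψ : EuclideanSpace ℂ (R × A × B)} (hψ : ‖ψ‖ = 1) :
    BddBelow (catalyticCosts ψ) := by
  refine ⟨-Real.logb 2 (Fintype.card B), ?_⟩
  rintro c ⟨K, L, hK, hL, h, rfl⟩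
  have h1 := le_mul_card_of_majorized hψ hK hL h
  have hB : Fintype.card B ≠ 0 := by
    intro h0
    rw [h0] at h1
    omega
  have hK' : (K : ℝ) ≠ 0 := by exact_mod_cast (by omega : K ≠ 0)
  have hL' : (0 : ℝ) < L := by exact_mod_cast hL
  have h2 : Real.logb 2 L ≤ Real.logb 2 (K * Fintype.card B : ℝ) :=
    Real.logb_le_logb_of_le one_lt_two hL' (by exact_mod_cast h1)
  rw [Real.logb_mul hK' (by exact_mod_cast hB)] at h2
  linarith

end Merging

theorem theorem3 {R A B : Type} [Fintype R] [Fintype A] [Fintype B]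
    [DecidableEq R] [DecidableEq A] [DecidableEq B]
    (ψ : EuclideanSpace ℂ (R × A × B)) (hψ : ‖ψ‖ = 1) :
    ((catalyticCosts ψ).Nonempty ∧ BddBelow (catalyticCosts ψ) ∧
      ∀ (K L p q : ℕ) (M : SuperOp ((A × Fin p) × (B × Fin q)) (Fin p × ((A × B) × Fin q))),
        IsExactMerging ψ K L M →
          Real.logb 2 K - Real.logb 2 L ≥ sInf (catalyticCosts ψ)) ∧
    (∃ c, IsLeast (nonCatalyticCosts ψ) c ∧
      ∀ (K p q : ℕ) (M : SuperOp ((A × Fin p) × (B × Fin q)) (Fin p × ((A × B) × Fin q))),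
        IsExactMerging ψ K 1 M → Real.logb 2 K ≥ c) := by
  classical
  refine ⟨⟨?_, bddBelow_catalyticCosts hψ, fun K L p q M h =>
    csInf_le (bddBelow_catalyticCosts hψ) ⟨K, L, h.one_le_K, h.one_le_L, h.majorized hψ, rfl⟩⟩, ?_⟩
  -- Non-emptiness: take `L = 1` and `K` the dimension of the space of the right-hand state.
  · obtain ⟨h1, h2⟩ := majorized_maxMixed_card hψ
      ((maxMixed_posSemidef 1).kronecker (reducedAB_posSemidef ψ))
      (trace_maxMixed_kronecker le_rfl (trace_reducedAB hψ))
    exact ⟨_, _, 1, h1, le_rfl, h2, rfl⟩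
  · have hex : ∃ K : ℕ, 1 ≤ K ∧ Majorized (maxMixed K ⊗ₖ reducedB ψ) (reducedAB ψ) :=
      ⟨_, majorized_maxMixed_card hψ (reducedAB_posSemidef ψ) (trace_reducedAB hψ)⟩
    have hmin : ∀ K : ℕ, 1 ≤ K → Majorized (maxMixed K ⊗ₖ reducedB ψ) (reducedAB ψ) →
        Real.logb 2 (Nat.find hex) ≤ Real.logb 2 K := fun K hK h =>
      Real.logb_le_logb_of_le one_lt_two (by exact_mod_cast (Nat.find_spec hex).1)
        (by exact_mod_cast Nat.find_min' hex ⟨hK, h⟩)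
    refine ⟨Real.logb 2 (Nat.find hex), ⟨⟨_, (Nat.find_spec hex).1, (Nat.find_spec hex).2, rfl⟩, ?_⟩,
      fun K p q M h => hmin K h.one_le_K (h.majorized_of_nonCatalytic hψ)⟩
    rintro c ⟨K, hK, h, rfl⟩
    exact hmin K hK h
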